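/- All Hilbert spaces are complex and all operators are bounded and linear. Let $m$ be a non-negative integer and let $H^2_m$ be the Hilbert space of power series $f(t)=\sum_{n\ge 0}a_nt^n$ with $a_n\in\mathbb C^m$ and $\|f\|^2=\sum_{n\ge0}\|a_n\|^2<\infty$, regarded as $\mathbb C^m$-valued analytic functions on the open unit disc $\mathbb D$; $\mathbb T$ denotes the unit circle. Definitions. An isometry $V$ on $H$ is pure if it has no non-zero closed invariant subspace $H_1$ such that $V|H_1$ is unitary on $H_1$. A Kolmogorov–Wold representation of $V$ is a unitary operator $R:H\to H^2_m$ such that $(RVR^{-1}f)(t)=t f(t)$ for all $f\in H^2_m$, $t\in\mathbb D$. An operator $S$ on $H$ is subnormal if there are a Hilbert space $K\supset H$ and a normal operator $N$ on $K$ with $NH\subset H$ and $N|H=S$ (a normal extension of $S$); it has no point masses if some normal extension of $S$ has no non-zero eigenvectors; it is pure if it has no non-zero closed invariant subspace on which its restriction is normal; a subnormal operator $S$ is of finite type if it is pure and $S^*S-SS^*$ has finite rank. The class $\mathrm{NDARN}_m$ consists of the $m\times m$ matrix functions $F$ on $\mathbb D$ which are rational (all entries are rational functions), analytic ($F$ is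 bounded and analytic on $\mathbb D$), normal (for almost every $t\in\mathbb T$ the radial boundary value $F(t)$ is defined and is a normal matrix) and non-degenerate (for every constant $c\in\mathbb C$, $\det(F(t)-cI)$ is not identically zero on $\mathbb D$). For such $F$, $T_F$ is the operator on $H^2_m$ given by $(T_Fg)(t)=F(t)g(t)$, $t\in\mathbb D$. Theorem. Let $V$ be a pure isometry on a Hilbert space $H$ with $\operatorname{codim}VH=m<\infty$, let $R:H\to H^2_m$ be any Kolmogorov–Wold representation of $V$, and let $S$ be a bounded operator on $H$. Then the following conditions are equivalent: (1) $S$ is a pure subnormal operator of finite type without point masses, and $SV=VS$; (2) $RSR^{-1}=T_F$ for some $F\in\mathrm{NDARN}_m$. -/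

import Mathlib

open scoped Matrix InnerProductSpace

noncomputable section

namespace VToeplitz

universe u

section Operators

variable {H : Type u} [NormedAddCommGroup H] [InnerProductSpace ℂ H] [CompleteSpace H]

/-- A normal extension of a bounded operator `S` on `H`: a Hilbert space `K` containing `H`
(through a linear isometric embedding) and a bounded normal operator on `K` that maps `H` into
itself and whose restriction to `H` is `S`. -/
structure NormalExtension (S : H →L[ℂ] H) where
  /-- the larger Hilbert space -/
  K : Type u
  [normedAddCommGroup : NormedAddCommGroup K]
  [innerProductSpace : InnerProductSpace ℂ K]
  [completeSpace : CompleteSpace K]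
  /-- the inclusion of `H` into the larger space -/
  incl : H →ₗᵢ[ℂ] K
  /-- the normal operator -/
  N : K →L[ℂ] K
  isStarNormal : IsStarNormal N
  N_incl : ∀ x : H, N (incl x) = incl (S x)

attribute [instance] NormalExtension.normedAddCommGroup NormalExtension.innerProductSpace
  NormalExtension.completeSpace

/-- `S` is subnormal: it has a normal extension. -/
def IsSubnormal (S : H →L[ℂ] H) : Prop :=
  Nonempty (NormalExtension S)

/-- `S` has no point masses: it has a normal extension without non-zero eigenvectors. -/
def HasNoPointMasses (S : H →L[ℂ] H) : Prop :=
  ∃ E : NormalExtension S, ∀ (c : ℂ) (x : E.K), E.N x = c • x → x = 0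

/-- `S` is pure: the only invariant (closed) subspace `M` such that the restriction
`T : M → M` of `S` is a normal operator on the Hilbert space `M` is the zero subspace.
(A subspace of a Hilbert space is closed iff it is complete.) -/
def IsPure (S : H →L[ℂ] H) : Prop :=
  ∀ (M : Submodule ℂ H) [CompleteSpace M] (T : M →L[ℂ] M),
    (∀ x : M, (T x : H) = S x) → IsStarNormal T → M = ⊥

/-- The self-commutator `[S*, S] = S* S - S S*`. -/
def selfCommutator (S : H →L[ℂ] H) : H →L[ℂ] H :=
  ContinuousLinearMap.adjoint S ∘L S - S ∘L ContinuousLinearMap.adjoint S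

/-- `S` is a subnormal operator of finite type: it is subnormal and pure, and its self-commutator
has finite rank. -/
structure IsSubnormalOfFiniteType (S : H →L[ℂ] H) : Prop where
  isSubnormal : IsSubnormal S
  isPure : IsPure S
  finite_rank : FiniteDimensional ℂ (LinearMap.range (selfCommutator S).toLinearMap)

/-- `V` is a pure isometry: it preserves norms, and the only invariant (closed) subspace `M` such
that the restriction `T : M → M` of `V` is unitary is the zero subspace. -/
structure IsPureIsometry (V : H →L[ℂ] H) : Prop where
  norm_map : ∀ x : H, ‖V x‖ = ‖x‖
  isPure : ∀ (M : Submodule ℂ H) [CompleteSpace M] (T : M →L[ℂ] M),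
    (∀ x : M, (T x : H) = V x) → T ∈ unitary (M →L[ℂ] M) → M = ⊥

end Operators

section Hardy

/-- The vector Hardy space `H²_m`: power series `∑ aₙ tⁿ` with `aₙ ∈ ℂᵐ` and
`∑ ‖aₙ‖² < ∞`, with the norm `‖f‖² = ∑ ‖aₙ‖²`; an element is represented by its sequence of
coefficients, and `HardySpace.eval` gives its values in the unit disc. -/
abbrev HardySpace (m : ℕ) : Type :=
  lp (fun _ : ℕ => EuclideanSpace ℂ (Fin m)) 2

/-- The value `f(t) = ∑ aₙ tⁿ` at a point `t` of the open unit disc. -/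
def HardySpace.eval {m : ℕ} (f : HardySpace m) (t : ℂ) : EuclideanSpace ℂ (Fin m) :=
  ∑' n : ℕ, t ^ n • f n

/-- The bounded operator `T` on `H²_m` is the analytic vector Toeplitz operator `T_F`, that is,
`(T g)(t) = F(t) g(t)` for `g ∈ H²_m` and `t` in the open unit disc. -/
def IsAnalyticToeplitz {m : ℕ} (F : ℂ → Matrix (Fin m) (Fin m) ℂ)
    (T : HardySpace m →L[ℂ] HardySpace m) : Prop :=
  ∀ (g : HardySpace m), ∀ t ∈ Metric.ball (0 : ℂ) 1,
    HardySpace.eval (T g) t = WithLp.toLp 2 (F t *ᵥ WithLp.ofLp (HardySpace.eval g t))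

/-- The operator `R S R⁻¹` on `H²_m`, for a unitary `R : H → H²_m` and an operator `S` on `H`. -/
def transport {m : ℕ} {H : Type u} [NormedAddCommGroup H] [InnerProductSpace ℂ H]
    (R : H ≃ₗᵢ[ℂ] HardySpace m) (S : H →L[ℂ] H) : HardySpace m →L[ℂ] HardySpace m :=
  (R.toContinuousLinearEquiv : H →L[ℂ] HardySpace m) ∘L S ∘L
    (R.symm.toContinuousLinearEquiv : HardySpace m →L[ℂ] H)

/-- The unitary operator `R : H → H²_m` is a Kolmogorov-Wold representation of `V`:
`(R V R⁻¹ f)(t) = t f(t)` for `f ∈ H²_m` and `t` in the open unit disc. -/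
def IsKolmogorovWold {m : ℕ} {H : Type u} [NormedAddCommGroup H] [InnerProductSpace ℂ H]
    (V : H →L[ℂ] H) (R : H ≃ₗᵢ[ℂ] HardySpace m) : Prop :=
  ∀ (f : HardySpace m), ∀ t ∈ Metric.ball (0 : ℂ) 1,
    HardySpace.eval (transport R V f) t = t • HardySpace.eval f t

end Hardy

section Symbols

variable {m : ℕ}

/-- Analytic matrix function on the disc: bounded and analytic on the open unit disc. -/
structure IsAnalyticSymbol (F : ℂ → Matrix (Fin m) (Fin m) ℂ) : Prop where
  differentiableOn : ∀ i j, DifferentiableOn ℂ (fun t => F t i j) (Metric.ball 0 1)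
  bounded : ∃ C : ℝ, ∀ t ∈ Metric.ball (0 : ℂ) 1, ∀ i j, ‖F t i j‖ ≤ C

/-- Rational matrix function on the disc: every entry is a quotient of two polynomials. -/
def IsRationalSymbol (F : ℂ → Matrix (Fin m) (Fin m) ℂ) : Prop :=
  ∀ i j, ∃ p q : Polynomial ℂ, q ≠ 0 ∧
    ∀ t ∈ Metric.ball (0 : ℂ) 1, q.eval t ≠ 0 → F t i j = p.eval t / q.eval t

/-- Normal matrix function: at almost every point of the unit circle the (radial) boundary value
of `F` is defined and is a normal matrix. -/
def IsNormalSymbol (F : ℂ → Matrix (Fin m) (Fin m) ℂ) : Prop :=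
  ∀ᵐ θ : ℝ, ∃ A : Matrix (Fin m) (Fin m) ℂ,
    Filter.Tendsto (fun r : ℝ => F (r * Complex.exp (θ * Complex.I)))
      (nhdsWithin 1 (Set.Iio 1)) (nhds A) ∧ IsStarNormal A

/-- Non-degenerate matrix function: for no constant `c` does `det (F(t) - c I)` vanish identically
on the open unit disc. -/
def IsNondegenerateSymbol (F : ℂ → Matrix (Fin m) (Fin m) ℂ) : Prop :=
  ∀ c : ℂ, ∃ t ∈ Metric.ball (0 : ℂ) 1, (F t - c • (1 : Matrix (Fin m) (Fin m) ℂ)).det ≠ 0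

/-- The class of non-degenerate analytic rational normal `m × m` matrix functions. -/
structure NDARN (F : ℂ → Matrix (Fin m) (Fin m) ℂ) : Prop where
  nondegenerate : IsNondegenerateSymbol F
  analytic : IsAnalyticSymbol F
  rational : IsRationalSymbol F
  normal : IsNormalSymbol F

end Symbols

end VToeplitz

end

open scoped Matrix InnerProductSpace

noncomputable section

/-! Boundary values on the circle are replaced by operators. The shift `V` has a minimal unitary
extension `U` on `H ⊕ H` (`IsShift.isUnitaryExtension`), and an operator `S` commuting with `V`
extends to some `N` commuting with `U` (`IsUnitaryExtension.exists_extension`); `N` plays the role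
of multiplication by the boundary values of the symbol. On the circle the conjugate of a polynomial
is, up to a power of the variable, a polynomial (`revConj`). Hence, for a symbol `P / q`, normality
of `N` and normality of the boundary values amount to the same polynomial identities
(`HasSymbol.isStarNormal_iff`, `IsQuotient.isNormalSymbol_iff`).

From (1) to (2): let `C` be the self-commutator of `S`. As `V ^ n x` tends weakly to zero and `C`
has finite rank, the defect of normality of `N`, which is invariant under `U`, must vanish
(`isStarNormal_of_finiteDimensional`). Then `ker C` consists of the `x` with `N† x` in `H`, so it is
invariant under `V`. Its orthogonal complement is finite-dimensional, invariant under `V†` and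
contains the backward shifts of the columns of the symbol; Cayley–Hamilton makes these rational
(`exists_hasSymbol_of_finiteDimensional`). A degenerate symbol would give `S` an eigenvector,
against purity (`HasSymbol.det_ne_zero`).

From (2) to (1): `N` is normal, and `C` vanishes on the range of some `r(V)` with `r ≠ 0`, whose
orthogonal complement is finite-dimensional (`HasSymbol.finiteDimensional_range`). The operator `det
(P - c q)(U)` sends wandering vectors into the range of `N - c`, which is orthogonal to the
eigenvectors for `c`; so there are none (`HasSymbol.eq_zero_of_eigen`). For purity, let `M` be the
largest subspace of `H` reducing `N`. Then `M ⊖ V M` is invariant under `S` and finite-dimensional,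
hence zero for lack of eigenvectors; so `M = V M`, which forces `M = 0`
(`isPure_of_no_eigenvectors`). -/

namespace VToeplitz

open scoped InnerProduct Topology
open Filter Polynomial

set_option linter.unusedSectionVars false

/-! ### Unilateral shifts and their unitary extensions. -/

section Shift

variable {E H K : Type*} [NormedAddCommGroup E] [InnerProductSpace ℂ E] [CompleteSpace E]
  [NormedAddCommGroup H] [InnerProductSpace ℂ H] [CompleteSpace H]
  [NormedAddCommGroup K] [InnerProductSpace ℂ K] [CompleteSpace K]

/-- `V` is a unilateral shift whose wandering subspace is parametrised isometrically by
`e : E → H`. -/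
structure IsShift (V : H →L[ℂ] H) (e : E →L[ℂ] H) : Prop where
  adj_apply (x : H) : (V†) (V x) = x
  adj_emb (a : E) : (e†) (e a) = a
  decomp (x : H) : V ((V†) x) + e ((e†) x) = x
  tendsto (x : H) : Tendsto (fun n : ℕ => ((V†) ^ n) x) atTop (𝓝 0)

/-- `U` is a unitary operator which extends `V` along the isometry `J`, and the translates of
the range of `J` under the powers of `U⁻¹` are dense. -/
structure IsUnitaryExtension (V : H →L[ℂ] H) (J : H →L[ℂ] K) (U : K →L[ℂ] K) : Prop where
  adj_apply (z : K) : (U†) (U z) = z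
  apply_adj (z : K) : U ((U†) z) = z
  adj_incl (x : H) : (J†) (J x) = x
  incl (x : H) : U (J x) = J (V x)
  tendsto (z : K) : Tendsto (fun n : ℕ => (U ^ n) z - J ((J†) ((U ^ n) z))) atTop (𝓝 0)

theorem pow_succ_apply' (A : H →L[ℂ] H) (n : ℕ) (x : H) : (A ^ (n + 1)) x = A ((A ^ n) x) := by
  rw [pow_succ']; rfl

theorem pow_succ_apply (A : H →L[ℂ] H) (n : ℕ) (x : H) : (A ^ (n + 1)) x = (A ^ n) (A x) := by
  rw [pow_succ]; rfl

theorem adjoint_pow (A : H →L[ℂ] H) (n : ℕ) : (A ^ n)† = (A†) ^ n :=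
  star_pow A n

namespace IsShift

variable {V : H →L[ℂ] H} {e : E →L[ℂ] H}

theorem adj_emb_apply (h : IsShift V e) (x : H) : (e†) (V x) = 0 := by
  have h1 := h.decomp (V x)
  rw [h.adj_apply] at h1
  have h2 : e ((e†) (V x)) = 0 := by simpa using h1
  rw [← h.adj_emb ((e†) (V x)), h2, map_zero]

theorem adj_apply_emb (h : IsShift V e) (a : E) : (V†) (e a) = 0 := by
  refine ext_inner_right ℂ fun y => ?_
  rw [ContinuousLinearMap.adjoint_inner_left, ← ContinuousLinearMap.adjoint_inner_right,
    h.adj_emb_apply, inner_zero_right, inner_zero_left]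

theorem adj_pow_pow (h : IsShift V e) (n : ℕ) (x : H) : ((V†) ^ n) ((V ^ n) x) = x := by
  induction n with
  | zero => simp
  | succ n ih => rw [pow_succ_apply, pow_succ_apply', h.adj_apply, ih]

theorem norm_sq (h : IsShift V e) (x : H) : ‖x‖ ^ 2 = ‖(V†) x‖ ^ 2 + ‖(e†) x‖ ^ 2 := by
  have h1 : ⟪x, V ((V†) x) + e ((e†) x)⟫_ℂ = ⟪x, x⟫_ℂ := by rw [h.decomp]
  rw [inner_add_right, ← ContinuousLinearMap.adjoint_inner_left V,
    ← ContinuousLinearMap.adjoint_inner_left e, inner_self_eq_norm_sq_to_K,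
    inner_self_eq_norm_sq_to_K, inner_self_eq_norm_sq_to_K] at h1
  exact_mod_cast h1.symm

theorem norm_apply (h : IsShift V e) (x : H) : ‖V x‖ = ‖x‖ := by
  have h1 := h.norm_sq (V x)
  rw [h.adj_apply, h.adj_emb_apply] at h1
  simpa using h1

theorem norm_emb (h : IsShift V e) (a : E) : ‖e a‖ = ‖a‖ := by
  have h1 := h.norm_sq (e a)
  rw [h.adj_apply_emb, h.adj_emb] at h1
  simpa using h1

theorem norm_pow_apply (h : IsShift V e) (n : ℕ) (x : H) : ‖(V ^ n) x‖ = ‖x‖ := by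
  induction n with
  | zero => simp
  | succ n ih => rw [pow_succ_apply', h.norm_apply, ih]

theorem norm_sq_eq_sum (h : IsShift V e) (x : H) (n : ℕ) :
    ‖x‖ ^ 2 = ∑ k ∈ Finset.range n, ‖(e†) (((V†) ^ k) x)‖ ^ 2 + ‖((V†) ^ n) x‖ ^ 2 := by
  induction n with
  | zero => simp
  | succ n ih =>
    rw [ih, Finset.sum_range_succ, h.norm_sq (((V†) ^ n) x), pow_succ_apply']
    ring

/-- The vectors `(e†) ((V† ^ k) x)` are the Taylor coefficients of `x`. If all vanish,
`norm_sq_eq_sum` gives `V† ^ n x` the norm of `x` for every `n`, while it tends to zero. -/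
theorem eq_zero_of_forall_adj (h : IsShift V e) {x : H} (hx : ∀ k, (e†) (((V†) ^ k) x) = 0) :
    x = 0 := by
  have h1 : ∀ n, ‖((V†) ^ n) x‖ = ‖x‖ := fun n => by
    have := h.norm_sq_eq_sum x n
    simp only [hx, norm_zero] at this
    exact ((sq_eq_sq₀ (norm_nonneg _) (norm_nonneg _)).1 (by simpa using this)).symm
  have h2 := (h.tendsto x).norm
  simp only [h1, norm_zero] at h2
  exact norm_eq_zero.1 (tendsto_nhds_unique tendsto_const_nhds h2)

theorem eq_zero_of_forall_inner (h : IsShift V e) {x : H}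
    (hx : ∀ k a, ⟪(V ^ k) (e a), x⟫_ℂ = 0) : x = 0 := by
  refine h.eq_zero_of_forall_adj fun k => ext_inner_left ℂ fun a => ?_
  rw [ContinuousLinearMap.adjoint_inner_right, ← adjoint_pow,
    ContinuousLinearMap.adjoint_inner_right, hx, inner_zero_right]

theorem eq_zero_of_adj_pow_norm (h : IsShift V e) {x : H} (hx : ∀ n : ℕ, ‖((V†) ^ n) x‖ = ‖x‖) :
    x = 0 := by
  have h2 := (h.tendsto x).norm
  simp only [hx, norm_zero] at h2
  exact norm_eq_zero.1 (tendsto_nhds_unique tendsto_const_nhds h2)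

end IsShift

namespace IsUnitaryExtension

variable {V : H →L[ℂ] H} {J : H →L[ℂ] K} {U : K →L[ℂ] K}

theorem norm_incl (h : IsUnitaryExtension V J U) (x : H) : ‖J x‖ = ‖x‖ := by
  have h1 : ⟪J x, J x⟫_ℂ = ⟪x, x⟫_ℂ := by
    rw [← ContinuousLinearMap.adjoint_inner_left, h.adj_incl]
  rw [inner_self_eq_norm_sq_to_K, inner_self_eq_norm_sq_to_K] at h1
  exact (sq_eq_sq₀ (norm_nonneg _) (norm_nonneg _)).1 (by exact_mod_cast h1)

theorem inner_incl (h : IsUnitaryExtension V J U) (x y : H) : ⟪J x, J y⟫_ℂ = ⟪x, y⟫_ℂ := by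
  rw [← ContinuousLinearMap.adjoint_inner_left, h.adj_incl]

theorem incl_injective (h : IsUnitaryExtension V J U) {x y : H} (hxy : J x = J y) : x = y := by
  rw [← h.adj_incl x, hxy, h.adj_incl]

theorem inner_apply (h : IsUnitaryExtension V J U) (x y : K) : ⟪U x, U y⟫_ℂ = ⟪x, y⟫_ℂ := by
  rw [← ContinuousLinearMap.adjoint_inner_left, h.adj_apply]

theorem norm_apply (h : IsUnitaryExtension V J U) (x : K) : ‖U x‖ = ‖x‖ := by
  have h1 := h.inner_apply x x
  rw [inner_self_eq_norm_sq_to_K, inner_self_eq_norm_sq_to_K] at h1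
  exact (sq_eq_sq₀ (norm_nonneg _) (norm_nonneg _)).1 (by exact_mod_cast h1)

theorem norm_pow_apply (h : IsUnitaryExtension V J U) (n : ℕ) (x : K) : ‖(U ^ n) x‖ = ‖x‖ := by
  induction n with
  | zero => simp
  | succ n ih => rw [pow_succ_apply', h.norm_apply, ih]

theorem mem_unitary (h : IsUnitaryExtension V J U) : U ∈ unitary (K →L[ℂ] K) := by
  constructor
  · ext z; exact h.adj_apply z
  · ext z; exact h.apply_adj z

theorem pow_incl (h : IsUnitaryExtension V J U) (n : ℕ) (x : H) :
    (U ^ n) (J x) = J ((V ^ n) x) := by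
  induction n with
  | zero => simp
  | succ n ih => rw [pow_succ_apply', pow_succ_apply', ih, h.incl]

theorem adj_pow_pow (h : IsUnitaryExtension V J U) (n : ℕ) (x : K) :
    ((U†) ^ n) ((U ^ n) x) = x := by
  induction n with
  | zero => simp
  | succ n ih => rw [pow_succ_apply, pow_succ_apply', h.adj_apply, ih]

theorem aeval_incl (h : IsUnitaryExtension V J U) (p : ℂ[X]) (x : H) :
    aeval U p (J x) = J (aeval V p x) := by
  simp only [aeval_eq_sum_range, _root_.sum_apply, _root_.smul_apply,
    map_sum, map_smul, h.pow_incl]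

theorem norm_sub_proj_sq (h : IsUnitaryExtension V J U) (z : K) :
    ‖z‖ ^ 2 = ‖(J†) z‖ ^ 2 + ‖z - J ((J†) z)‖ ^ 2 := by
  have h1 : ⟪J ((J†) z), z - J ((J†) z)⟫_ℂ = 0 := by
    rw [← ContinuousLinearMap.adjoint_inner_right, map_sub, h.adj_incl, sub_self,
      inner_zero_right]
  have h2 := norm_add_sq_eq_norm_sq_add_norm_sq_of_inner_eq_zero _ _ h1
  rw [add_sub_cancel, h.norm_incl] at h2
  rw [pow_two, pow_two, pow_two, h2]

theorem eq_zero_of_forall_adj_incl (h : IsUnitaryExtension V J U) {z : K}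
    (hz : ∀ n : ℕ, (J†) ((U ^ n) z) = 0) : z = 0 := by
  have h2 := (h.tendsto z).norm
  simp only [hz, map_zero, sub_zero, h.norm_pow_apply, norm_zero] at h2
  exact norm_eq_zero.1 (tendsto_nhds_unique tendsto_const_nhds h2)

variable {e : E →L[ℂ] H}

theorem eq_zero_of_forall_inner (h : IsUnitaryExtension V J U) (hV : IsShift V e) {z : K}
    (hz : ∀ k n a, ⟪(U ^ k) (J (e a)), (U ^ n) z⟫_ℂ = 0) : z = 0 := by
  refine h.eq_zero_of_forall_adj_incl fun n => hV.eq_zero_of_forall_inner fun k a => ?_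
  rw [ContinuousLinearMap.adjoint_inner_right, ← h.pow_incl, hz]

/-- Elementary because `U` is unitary: no Fuglede theorem is needed, only conjugation of the adjoint
relation by `U`. -/
theorem commute_star (h : IsUnitaryExtension V J U) {A : K →L[ℂ] K} (hA : Commute A U) :
    Commute (star A) U := by
  have h1 : star U * U = 1 := h.mem_unitary.1
  have h2 : U * star U = 1 := h.mem_unitary.2
  have h3 : star U * star A = star A * star U := by
    rw [← star_mul, ← star_mul, hA.eq]
  calc star A * U = U * (star U * star A) * U := by rw [← mul_assoc, h2, one_mul]
    _ = U * star A * (star U * U) := by rw [h3]; simp only [mul_assoc]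
    _ = U * star A := by rw [h1, mul_one]

/-- An operator commuting with `U` that kills the wandering vectors is zero. -/
theorem eq_zero_of_commute (h : IsUnitaryExtension V J U) (hV : IsShift V e) {A : K →L[ℂ] K}
    (hA : Commute A U) (h0 : ∀ a, A (J (e a)) = 0) : A = 0 := by
  -- `eq_zero_of_forall_inner` tests vectors against translates of wandering vectors, so the adjoint
  -- is tested and `A` is moved onto those vectors.
  have h1 : star A = 0 := by
    ext z
    refine h.eq_zero_of_forall_inner hV fun k n a => ?_
    have h2 := (h.commute_star hA).pow_right n
    have h3 : (U ^ n) (star A z) = (star A) ((U ^ n) z) := (congrArg (· z) h2.eq).symm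
    have h4 : A ((U ^ k) (J (e a))) = (U ^ k) (A (J (e a))) :=
      congrArg (· (J (e a))) (hA.pow_right k).eq
    rw [h3, ContinuousLinearMap.star_eq_adjoint, ContinuousLinearMap.adjoint_inner_right, h4, h0]
    simp
  exact star_eq_zero.1 h1

end IsUnitaryExtension

end Shift

/-! ### Construction of the unitary extension and of commuting extensions. -/

section Extension

variable {E H K : Type*} [NormedAddCommGroup E] [InnerProductSpace ℂ E] [CompleteSpace E]
  [NormedAddCommGroup H] [InnerProductSpace ℂ H] [CompleteSpace H]
  [NormedAddCommGroup K] [InnerProductSpace ℂ K] [CompleteSpace K]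

/-- The inclusion of `H` as the first summand of `H ⊕ H`. -/
def sumIncl (H : Type*) [NormedAddCommGroup H] [InnerProductSpace ℂ H] :
    H →L[ℂ] WithLp 2 (H × H) :=
  (WithLp.prodContinuousLinearEquiv 2 ℂ H H).symm.toContinuousLinearMap ∘L
    ContinuousLinearMap.inl ℂ H H

/-- The operator matrix `[[A, B], [C, D]]` on `H ⊕ H`. -/
def blockOp (A B C D : H →L[ℂ] H) : WithLp 2 (H × H) →L[ℂ] WithLp 2 (H × H) :=
  (WithLp.prodContinuousLinearEquiv 2 ℂ H H).symm.toContinuousLinearMap ∘L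
    ((A.coprod B).prod (C.coprod D)) ∘L
    (WithLp.prodContinuousLinearEquiv 2 ℂ H H).toContinuousLinearMap

theorem blockOp_fst (A B C D : H →L[ℂ] H) (z : WithLp 2 (H × H)) :
    (blockOp A B C D z).fst = A z.fst + B z.snd := rfl

theorem blockOp_snd (A B C D : H →L[ℂ] H) (z : WithLp 2 (H × H)) :
    (blockOp A B C D z).snd = C z.fst + D z.snd := rfl

theorem sumIncl_fst (x : H) : (sumIncl H x).fst = x := rfl

theorem sumIncl_snd (x : H) : (sumIncl H x).snd = 0 := rfl

theorem sum_ext {z w : WithLp 2 (H × H)} (h1 : z.fst = w.fst) (h2 : z.snd = w.snd) : z = w :=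
  WithLp.ofLp_injective 2 (Prod.ext h1 h2)

theorem adjoint_sumIncl_apply (z : WithLp 2 (H × H)) : ((sumIncl H)†) z = z.fst := by
  refine ext_inner_right ℂ fun y => ?_
  rw [ContinuousLinearMap.adjoint_inner_left, WithLp.prod_inner_apply]
  simp [sumIncl_fst, sumIncl_snd]

theorem adjoint_blockOp (A B C D : H →L[ℂ] H) :
    (blockOp A B C D)† = blockOp (A†) (C†) (B†) (D†) := by
  refine ((ContinuousLinearMap.eq_adjoint_iff _ _).2 fun x y => ?_).symm
  rw [WithLp.prod_inner_apply, WithLp.prod_inner_apply]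
  change ⟪(A†) x.fst + (C†) x.snd, y.fst⟫_ℂ + ⟪(B†) x.fst + (D†) x.snd, y.snd⟫_ℂ =
    ⟪x.fst, A y.fst + B y.snd⟫_ℂ + ⟪x.snd, C y.fst + D y.snd⟫_ℂ
  simp only [inner_add_left, inner_add_right,
    ContinuousLinearMap.adjoint_inner_left]
  ring

/-- The minimal unitary extension of a unilateral shift, as an operator matrix. -/
def unitaryExtension (V : H →L[ℂ] H) : WithLp 2 (H × H) →L[ℂ] WithLp 2 (H × H) :=
  blockOp V (1 - V ∘L (V†)) 0 (V†)

theorem IsShift.isUnitaryExtension {V : H →L[ℂ] H} {e : E →L[ℂ] H} (h : IsShift V e) :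
    IsUnitaryExtension V (sumIncl H) (unitaryExtension V) := by
  have hadj : (unitaryExtension V)† = blockOp (V†) 0 (1 - V ∘L (V†)) V := by
    rw [unitaryExtension, adjoint_blockOp, map_sub, ContinuousLinearMap.adjoint_comp,
      ContinuousLinearMap.adjoint_adjoint, ContinuousLinearMap.adjoint_one, map_zero]
  have hsnd : ∀ (n : ℕ) (z : WithLp 2 (H × H)),
      (((unitaryExtension V) ^ n) z).snd = ((V†) ^ n) z.snd := by
    intro n z
    induction n with
    | zero => simp
    | succ n ih =>
      rw [pow_succ_apply', pow_succ_apply', unitaryExtension, blockOp_snd, ← unitaryExtension, ih]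
      simp
  refine ⟨fun z => ?_, fun z => ?_, fun x => ?_, fun x => ?_, fun z => ?_⟩
  · rw [hadj]
    apply sum_ext
    · simp [blockOp_fst, blockOp_snd, unitaryExtension, h.adj_apply]
    · simp [blockOp_fst, blockOp_snd, unitaryExtension, h.adj_apply]
  · rw [hadj]
    apply sum_ext
    · simp [blockOp_fst, blockOp_snd, unitaryExtension, h.adj_apply]
    · simp [blockOp_fst, blockOp_snd, unitaryExtension, h.adj_apply]
  · rw [adjoint_sumIncl_apply, sumIncl_fst]
  · apply sum_ext <;> simp [blockOp_fst, blockOp_snd, unitaryExtension, sumIncl_fst, sumIncl_snd]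
  -- The part of `U ^ n z` outside `H` is its second component `V† ^ n z.snd`.
  · rw [tendsto_zero_iff_norm_tendsto_zero]
    have h1 := (h.tendsto z.snd).norm
    rw [norm_zero] at h1
    refine h1.congr fun n => ?_
    rw [adjoint_sumIncl_apply, WithLp.prod_norm_eq_of_L2]
    simp only [WithLp.sub_fst, WithLp.sub_snd, sumIncl_fst, sumIncl_snd, hsnd]
    simp

/-- An operator commuting with `V` extends to an operator commuting with the unitary extension
of `V`. -/
theorem IsUnitaryExtension.exists_extension {V : H →L[ℂ] H} {J : H →L[ℂ] K} {U : K →L[ℂ] K}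
    (h : IsUnitaryExtension V J U) {S : H →L[ℂ] H} (hS : Commute S V) :
    ∃ N : K →L[ℂ] K, Commute N U ∧ ∀ x, N (J x) = J (S x) := by
  -- On `U† ^ k J H` this sequence is constant from index `k` on; the union of these subspaces is
  -- dense and the norms are at most `‖S‖`, so the sequence converges strongly.
  let g : ℕ → K →L[ℂ] K := fun n => ((U†) ^ n) ∘L J ∘L S ∘L (J†) ∘L (U ^ n)
  have hnadj : ∀ n z, ‖((U†) ^ n) z‖ = ‖z‖ := by
    intro n z
    induction n with
    | zero => simp
    | succ n ih =>
      rw [pow_succ_apply', ← h.norm_apply, h.apply_adj, ih]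
  have hJadj : ∀ z, ‖(J†) z‖ ≤ ‖z‖ := fun z => by
    have := h.norm_sub_proj_sq z
    nlinarith [norm_nonneg z, norm_nonneg ((J†) z), sq_nonneg ‖z - J ((J†) z)‖]
  have hg : ∀ n z, ‖g n z‖ ≤ ‖S‖ * ‖z‖ := fun n z => by
    simp only [g, ContinuousLinearMap.comp_apply]
    rw [hnadj, h.norm_incl]
    refine (S.le_opNorm _).trans (mul_le_mul_of_nonneg_left ?_ (norm_nonneg _))
    exact (hJadj _).trans (h.norm_pow_apply _ _).le
  have hstab : ∀ k n z x, (U ^ k) z = J x → g (k + n) z = ((U†) ^ k) (J (S x)) := by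
    intro k n z x hzx
    simp only [g, ContinuousLinearMap.comp_apply]
    have h1 : (U ^ (k + n)) z = J ((V ^ n) x) := by
      rw [add_comm, pow_add, mul_apply_eq_comp, hzx, h.pow_incl]
    have h2 : S ((V ^ n) x) = (V ^ n) (S x) := congrArg (· x) (hS.pow_right n).eq
    rw [h1, h.adj_incl, h2, ← h.pow_incl, pow_add, mul_apply_eq_comp, h.adj_pow_pow]
  have hcauchy : ∀ z, CauchySeq fun n => g n z := by
    intro z
    rw [Metric.cauchySeq_iff']
    intro ε hε
    -- Two terms `g n (z - w)` will each cost `‖S‖ * ‖z - w‖`; the summand 1 covers `S = 0`.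
    have hC : 0 < 2 * ‖S‖ + 1 := by positivity
    obtain ⟨k, hk⟩ := ((Metric.tendsto_atTop.1 (h.tendsto z)) (ε / (2 * ‖S‖ + 1))
      (div_pos hε hC))
    have hr := hk k le_rfl
    rw [dist_zero_right] at hr
    set x := (J†) ((U ^ k) z) with hx
    set w := ((U†) ^ k) (J x) with hw
    have hUU : ∀ n y, (U ^ n) (((U†) ^ n) y) = y := by
      intro n y
      induction n with
      | zero => simp
      | succ n ih => rw [pow_succ_apply, pow_succ_apply', h.apply_adj, ih]
    have hUw : (U ^ k) w = J x := hUU k _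
    have hzw : ‖z - w‖ = ‖(U ^ k) z - J x‖ := by
      rw [← h.norm_pow_apply k, map_sub, hUw]
    refine ⟨k, fun n hn => ?_⟩
    obtain ⟨l, rfl⟩ := Nat.exists_eq_add_of_le hn
    have e1 := hstab k l w x hUw
    have e2 := hstab k 0 w x hUw
    rw [add_zero] at e2
    have e3 : g (k + l) z - g k z = g (k + l) (z - w) - g k (z - w) := by
      rw [map_sub, map_sub, e1, e2]; abel
    rw [dist_eq_norm, e3]
    refine (norm_sub_le _ _).trans_lt ?_
    have e4 := hg (k + l) (z - w)
    have e5 := hg k (z - w)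
    rw [lt_div_iff₀ hC, ← hzw] at hr
    nlinarith [norm_nonneg (z - w)]
  choose f hf using fun z => cauchySeq_tendsto_of_complete (hcauchy z)
  let N : K →L[ℂ] K := continuousLinearMapOfTendsto g (tendsto_pi_nhds.2 hf)
  have hN : ∀ z, N z = f z := fun z => rfl
  refine ⟨N, ?_, fun x => ?_⟩
  · ext z
    change N (U z) = U (N z)
    rw [hN, hN]
    refine tendsto_nhds_unique (hf (U z)) ?_
    have h1 := ((U.continuous.tendsto _).comp ((tendsto_add_atTop_iff_nat 1).2 (hf z)))
    refine h1.congr fun n => ?_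
    simp only [g, ContinuousLinearMap.comp_apply, Function.comp]
    rw [pow_succ_apply' (U†), h.apply_adj, pow_succ_apply U]
  · rw [hN]
    refine tendsto_nhds_unique (hf (J x)) ?_
    refine tendsto_const_nhds.congr fun n => ?_
    have := hstab 0 n (J x) x (by simp)
    rw [zero_add] at this
    rw [this]; simp

end Extension

/-! ### Conjugate-reversed polynomials. -/

section Polynomials

/-- The polynomial `X ^ d * conj p (1 / X)`, for `p` of degree at most `d`. -/
def revConj (d : ℕ) (p : ℂ[X]) : ℂ[X] :=
  ∑ k ∈ Finset.range (d + 1), C (starRingEnd ℂ (p.coeff k)) * X ^ (d - k)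

/-- For unitary `u` and `k ≤ d`, `u ^ (d - k) = u ^ d * star u ^ k`. Thus adjoints of polynomials in
`u` become polynomials at the price of a factor `u ^ d`. -/
theorem aeval_revConj {A : Type*} [Ring A] [StarRing A] [Algebra ℂ A] [StarModule ℂ A] {u : A}
    (hu : u ∈ unitary A) {d : ℕ} {p : ℂ[X]} (hp : p.natDegree ≤ d) :
    aeval u (revConj d p) = u ^ d * star (aeval u p) := by
  have hu' : ∀ k, u ^ k * star u ^ k = 1 := fun k => by
    rw [← star_pow]; exact (pow_mem hu k).2
  rw [aeval_eq_sum_range' (Nat.lt_succ_of_le hp), revConj, map_sum, star_sum, Finset.mul_sum]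
  refine Finset.sum_congr rfl fun k hk => ?_
  have hk' : k ≤ d := Nat.lt_succ_iff.1 (Finset.mem_range.1 hk)
  obtain ⟨l, rfl⟩ := Nat.exists_eq_add_of_le' hk'
  rw [star_smul, star_pow, mul_smul_comm, pow_add, mul_assoc, hu', mul_one, Nat.add_sub_cancel,
    map_mul, map_pow, aeval_X, aeval_C, ← Algebra.smul_def]
  rfl

theorem eval_revConj {t : ℂ} (ht : ‖t‖ = 1) {d : ℕ} {p : ℂ[X]} (hp : p.natDegree ≤ d) :
    (revConj d p).eval t = t ^ d * star (p.eval t) := by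
  have hu : t ∈ unitary ℂ := by
    rw [Unitary.mem_iff]
    have h1 : star t * t = 1 := by
      rw [Complex.star_def, Complex.conj_mul', ht]; simp
    exact ⟨h1, by rw [mul_comm]; exact h1⟩
  have := aeval_revConj hu hp
  simpa only [coe_aeval_eq_eval] using this

theorem revConj_ne_zero {d : ℕ} {p : ℂ[X]} (hd : p.natDegree ≤ d) (hp : p ≠ 0) :
    revConj d p ≠ 0 := by
  intro h
  have h1 : (revConj d p).coeff (d - p.natDegree) = starRingEnd ℂ p.leadingCoeff := by
    rw [revConj, finsetSum_coeff, Finset.sum_eq_single p.natDegree]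
    · simp
    · intro k hk hne
      have := Finset.mem_range.1 hk
      rw [coeff_C_mul, coeff_X_pow, if_neg (by omega), mul_zero]
    · intro h2
      exact absurd (Finset.mem_range.2 (Nat.lt_succ_of_le hd)) h2
  rw [h, coeff_zero] at h1
  exact hp (leadingCoeff_eq_zero.1 ((map_eq_zero _).1 h1.symm))

end Polynomials

/-! ### Polynomials in the shift and in its unitary extension. -/

section PolynomialCalculus

variable {E H K : Type*} [NormedAddCommGroup E] [InnerProductSpace ℂ E] [CompleteSpace E]
  [NormedAddCommGroup H] [InnerProductSpace ℂ H] [CompleteSpace H]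
  [NormedAddCommGroup K] [InnerProductSpace ℂ K] [CompleteSpace K]
  {V : H →L[ℂ] H} {e : E →L[ℂ] H} {J : H →L[ℂ] K} {U : K →L[ℂ] K}

theorem aeval_mul_apply (A : H →L[ℂ] H) (p q : ℂ[X]) (x : H) :
    aeval A (p * q) x = aeval A p (aeval A q x) := by
  rw [map_mul]; rfl

theorem commute_aeval {A B : H →L[ℂ] H} (h : Commute A B) (p : ℂ[X]) :
    Commute A (aeval B p) := by
  rw [aeval_eq_sum_range]
  exact Commute.sum_right _ _ _ fun k _ => (h.pow_right k).smul_right _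

/-- An eigenvalue is unimodular, so all `U ^ n z` are equally far from `J H`; the distance tends to
zero, so `z` lies in `J H`. There it gives an eigenvector of `V†` with unimodular eigenvalue, whose
iterates cannot tend to zero. -/
theorem IsUnitaryExtension.eq_zero_of_eigen (h : IsUnitaryExtension V J U) (hV : IsShift V e)
    {a : ℂ} {z : K} (hz : U z = a • z) : z = 0 := by
  by_contra hne
  have ha : ‖a‖ = 1 := by
    have h1 := h.norm_apply z
    rw [hz, norm_smul] at h1
    exact mul_right_cancel₀ (norm_ne_zero_iff.2 hne) (by rw [h1, one_mul])
  have hpow : ∀ n : ℕ, (U ^ n) z = a ^ n • z := by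
    intro n
    induction n with
    | zero => simp
    | succ n ih => rw [pow_succ_apply', ih, map_smul, hz, smul_smul, pow_succ]
  have h1 : z = J ((J†) z) := by
    have h2 := (h.tendsto z).norm
    have h3 : ∀ n : ℕ, ‖(U ^ n) z - J ((J†) ((U ^ n) z))‖ = ‖z - J ((J†) z)‖ := fun n => by
      rw [hpow, map_smul, map_smul, ← smul_sub, norm_smul, norm_pow, ha, one_pow, one_mul]
    simp only [h3, norm_zero] at h2
    exact sub_eq_zero.1 (norm_eq_zero.1 (tendsto_nhds_unique tendsto_const_nhds h2))
  set x := (J†) z with hx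
  have ha0 : a ≠ 0 := by rintro rfl; simp at ha
  have h4 : V x = a • x := h.incl_injective (by rw [← h.incl, ← h1, hz, map_smul, ← h1])
  have h5 : (V†) x = a⁻¹ • x := by
    have h6 := congrArg (V†) h4
    rw [hV.adj_apply, map_smul] at h6
    rw [h6, smul_smul, inv_mul_cancel₀ ha0, one_smul, ← h6]
  have h6 : ∀ n : ℕ, ((V†) ^ n) x = a⁻¹ ^ n • x := by
    intro n
    induction n with
    | zero => simp
    | succ n ih => rw [pow_succ_apply', ih, map_smul, h5, smul_smul, pow_succ]
  have h7 : x = 0 := hV.eq_zero_of_adj_pow_norm fun n => by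
    rw [h6, norm_smul, norm_pow, norm_inv, ha, inv_one, one_pow, one_mul]
  exact hne (by rw [h1, h7, map_zero])

/-- Linear factors are injective by `eq_zero_of_eigen` and are peeled off one at a time. This is
what permits cancelling denominators. -/
theorem IsUnitaryExtension.aeval_injective (h : IsUnitaryExtension V J U) (hV : IsShift V e)
    {p : ℂ[X]} (hp : p ≠ 0) {z : K} (hz : aeval U p z = 0) : z = 0 := by
  obtain ⟨n, hn⟩ : ∃ n, p.natDegree = n := ⟨_, rfl⟩
  induction n generalizing p z with
  | zero =>
    rw [eq_C_of_natDegree_eq_zero hn] at hz hp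
    rw [aeval_C, Algebra.algebraMap_eq_smul_one] at hz
    exact (smul_eq_zero.1 hz).resolve_left fun h0 => hp (by rw [h0, C_0])
  | succ n ih =>
    obtain ⟨a, ha⟩ := IsAlgClosed.exists_root p (by
      intro h0
      have := natDegree_eq_zero_iff_degree_le_zero.2 h0.le
      omega)
    obtain ⟨q, rfl⟩ := dvd_iff_isRoot.2 ha
    have hq : q ≠ 0 := right_ne_zero_of_mul hp
    rw [natDegree_mul (X_sub_C_ne_zero a) hq, natDegree_X_sub_C] at hn
    rw [aeval_mul_apply, map_sub, aeval_X, aeval_C, Algebra.algebraMap_eq_smul_one] at hz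
    refine ih hq (h.eq_zero_of_eigen hV (a := a) ?_) (by omega)
    exact sub_eq_zero.1 hz

theorem IsUnitaryExtension.aeval_injective_base (h : IsUnitaryExtension V J U) (hV : IsShift V e)
    {p : ℂ[X]} (hp : p ≠ 0) {x : H} (hx : aeval V p x = 0) : x = 0 := by
  refine h.incl_injective ?_
  rw [map_zero]
  exact h.aeval_injective hV hp (by rw [h.aeval_incl, hx, map_zero])

theorem IsUnitaryExtension.aeval_revConj (h : IsUnitaryExtension V J U) {d : ℕ} {p : ℂ[X]}
    (hp : p.natDegree ≤ d) (z : K) :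
    aeval U (revConj d p) z = (U ^ d) (((aeval U p)†) z) :=
  congrArg (· z) (VToeplitz.aeval_revConj h.mem_unitary hp)

/-- `V` is not unitary, but `V† ^ d` still cancels on the left: `V† ^ d V ^ (d - k) = V† ^ k`. -/
theorem IsShift.adj_pow_aeval_revConj (hV : IsShift V e) {d : ℕ} {p : ℂ[X]}
    (hp : p.natDegree ≤ d) (x : H) :
    ((V†) ^ d) (aeval V (revConj d p) x) = ((aeval V p)†) x := by
  rw [aeval_eq_sum_range' (Nat.lt_succ_of_le hp), revConj, map_sum, map_sum, _root_.sum_apply,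
    _root_.sum_apply, map_sum]
  refine Finset.sum_congr rfl fun k hk => ?_
  have hk' : k ≤ d := Nat.lt_succ_iff.1 (Finset.mem_range.1 hk)
  obtain ⟨l, rfl⟩ := Nat.exists_eq_add_of_le hk'
  rw [Nat.add_sub_cancel_left, map_smulₛₗ, adjoint_pow, map_mul, map_pow, aeval_X, aeval_C,
    ← Algebra.smul_def, _root_.smul_apply, map_smul, pow_add, mul_apply_eq_comp, hV.adj_pow_pow]
  rfl

theorem IsShift.ker_adj_pow_succ_le (hV : IsShift V e) (n : ℕ) :
    ((V†) ^ (n + 1)).ker ≤ (((V†) ^ n).ker).map (V : H →ₗ[ℂ] H) ⊔ (e : E →ₗ[ℂ] H).range := by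
  intro x hx
  rw [← hV.decomp x]
  refine Submodule.add_mem_sup (Submodule.mem_map_of_mem ?_) ⟨_, rfl⟩
  rw [LinearMap.mem_ker] at hx ⊢
  change ((V†) ^ (n + 1)) x = 0 at hx
  rwa [pow_succ_apply] at hx

theorem IsShift.finiteDimensional_ker_adj_pow [FiniteDimensional ℂ E] (hV : IsShift V e) (n : ℕ) :
    FiniteDimensional ℂ ((V†) ^ n).ker := by
  induction n with
  | zero =>
    have : ((V†) ^ 0).ker = ⊥ := by
      rw [eq_bot_iff]; intro x hx; simpa using hx
    rw [this]; infer_instance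
  | succ n ih => exact Submodule.finiteDimensional_of_le (hV.ker_adj_pow_succ_le n)

/-- By `adj_pow_aeval_revConj` the injective operator `(revConj d p)(V)` maps this kernel into that
of `V† ^ d`, which is finite-dimensional. -/
theorem IsUnitaryExtension.finiteDimensional_ker_adj_aeval [FiniteDimensional ℂ E]
    (h : IsUnitaryExtension V J U) (hV : IsShift V e) {p : ℂ[X]} (hp : p ≠ 0) :
    FiniteDimensional ℂ ((aeval V p)†).ker := by
  have := hV.finiteDimensional_ker_adj_pow p.natDegree
  let T : ((aeval V p)†).ker →ₗ[ℂ] ((V†) ^ p.natDegree).ker :=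
    ((aeval V (revConj p.natDegree p)).toLinearMap.comp (Submodule.subtype _)).codRestrict _
      fun x => by
        have hx : ((aeval V p)†) (x : H) = 0 := x.2
        rw [LinearMap.mem_ker]
        exact (hV.adj_pow_aeval_revConj le_rfl _).trans hx
  refine FiniteDimensional.of_injective T fun x y hxy => ?_
  have h1 : aeval V (revConj p.natDegree p) (x : H) = aeval V (revConj p.natDegree p) (y : H) :=
    congrArg Subtype.val hxy
  refine Subtype.ext (sub_eq_zero.1 (h.aeval_injective_base hV (revConj_ne_zero le_rfl hp) ?_))
  rw [map_sub, h1, sub_self]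

variable {m : ℕ} {ε : EuclideanSpace ℂ (Fin m) →L[ℂ] H}

/-- The vector `ε eⱼ`, for the standard basis vector `eⱼ` of `ℂᵐ`. -/
def gen (ε : EuclideanSpace ℂ (Fin m) →L[ℂ] H) (j : Fin m) : H := ε (EuclideanSpace.single j 1)

theorem emb_eq_sum (a : EuclideanSpace ℂ (Fin m)) : ε a = ∑ j, a j • gen ε j := by
  conv_lhs => rw [← (EuclideanSpace.basisFun (Fin m) ℂ).sum_repr a]
  simp [map_sum, gen]

/-- The elements of the kernel of a power of the adjoint of a shift are vector polynomials. -/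
theorem IsShift.exists_polynomial_of_adj_pow (hV : IsShift V ε) (n : ℕ) {x : H}
    (hx : ((V†) ^ n) x = 0) : ∃ p : Fin m → ℂ[X], x = ∑ i, aeval V (p i) (gen ε i) := by
  induction n generalizing x with
  | zero => exact ⟨0, by simpa using hx⟩
  | succ n ih =>
    rw [pow_succ_apply] at hx
    obtain ⟨p, hp⟩ := ih hx
    refine ⟨fun i => X * p i + C (((ε†) x) i), ?_⟩
    conv_lhs => rw [← hV.decomp x, hp, emb_eq_sum]
    rw [map_sum, ← Finset.sum_add_distrib]
    refine Finset.sum_congr rfl fun i _ => ?_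
    rw [map_add, map_mul, aeval_X, aeval_C, Algebra.algebraMap_eq_smul_one]
    rfl

end PolynomialCalculus

/-! ### Operators with rational symbol: normality, self-commutator, eigenvectors. -/

section Symbol

variable {H K : Type*}
  [NormedAddCommGroup H] [InnerProductSpace ℂ H] [CompleteSpace H]
  [NormedAddCommGroup K] [InnerProductSpace ℂ K] [CompleteSpace K]
  {m : ℕ} {V : H →L[ℂ] H} {e : EuclideanSpace ℂ (Fin m) →L[ℂ] H}
  {J : H →L[ℂ] K} {U : K →L[ℂ] K} {S : H →L[ℂ] H} {N : K →L[ℂ] K}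

theorem commute_apply {A B : H →L[ℂ] H} (h : Commute A B) (x : H) : A (B x) = B (A x) :=
  congrArg (· x) h.eq

namespace IsShift

theorem inner_gen (hV : IsShift V e) (i j : Fin m) :
    ⟪gen e i, gen e j⟫_ℂ = if i = j then 1 else 0 := by
  rw [gen, gen, ← ContinuousLinearMap.adjoint_inner_left, hV.adj_emb,
    EuclideanSpace.inner_single_left]
  simp

theorem inner_emb_apply (hV : IsShift V e) (a : EuclideanSpace ℂ (Fin m)) (x : H) :
    ⟪e a, V x⟫_ℂ = 0 := by
  rw [← ContinuousLinearMap.adjoint_inner_left, hV.adj_apply_emb, inner_zero_left]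

theorem inner_pow_pow (hV : IsShift V e) (n : ℕ) (x y : H) :
    ⟪(V ^ n) x, (V ^ n) y⟫_ℂ = ⟪x, y⟫_ℂ := by
  rw [← ContinuousLinearMap.adjoint_inner_left, adjoint_pow, hV.adj_pow_pow]

theorem inner_pow_gen (hV : IsShift V e) (k n : ℕ) (i j : Fin m) :
    ⟪(V ^ k) (gen e i), (V ^ n) (gen e j)⟫_ℂ = if i = j ∧ k = n then 1 else 0 := by
  rcases lt_trichotomy k n with h | rfl | h
  · obtain ⟨l, rfl⟩ := Nat.exists_eq_add_of_lt h
    rw [add_assoc, pow_add, mul_apply_eq_comp, hV.inner_pow_pow, pow_succ_apply', gen,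
      hV.inner_emb_apply, if_neg (by omega)]
  · rw [hV.inner_pow_pow, hV.inner_gen]; simp
  · obtain ⟨l, rfl⟩ := Nat.exists_eq_add_of_lt h
    rw [add_assoc, pow_add, mul_apply_eq_comp, hV.inner_pow_pow, pow_succ_apply', gen, gen,
      ← inner_conj_symm, hV.inner_emb_apply, if_neg (by omega), map_zero]

theorem inner_aeval_gen (hV : IsShift V e) (p : ℂ[X]) (n : ℕ) (i j : Fin m) :
    ⟪aeval V p (gen e i), (V ^ n) (gen e j)⟫_ℂ =
      if i = j then starRingEnd ℂ (p.coeff n) else 0 := by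
  rw [aeval_eq_sum_range' (Nat.lt_succ_of_le (le_max_left p.natDegree n)), _root_.sum_apply,
    sum_inner]
  simp only [_root_.smul_apply, inner_smul_left, hV.inner_pow_gen]
  rw [Finset.sum_eq_single n]
  · simp
  · intro k _ hk
    rw [if_neg (fun h => hk h.2), mul_zero]
  · intro h
    exact absurd (Finset.mem_range.2 (Nat.lt_succ_of_le (le_max_right _ _))) h

theorem polynomial_eq_zero (hV : IsShift V e) {p : Fin m → ℂ[X]}
    (h : ∑ i, aeval V (p i) (gen e i) = 0) (j : Fin m) : p j = 0 := by
  ext n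
  have h1 : ⟪∑ i, aeval V (p i) (gen e i), (V ^ n) (gen e j)⟫_ℂ = 0 := by
    rw [h, inner_zero_left]
  rw [sum_inner] at h1
  simp only [hV.inner_aeval_gen] at h1
  simpa using h1

theorem clm_ext_zero (hV : IsShift V e) {F : Type*} [NormedAddCommGroup F]
    [InnerProductSpace ℂ F] [CompleteSpace F] {T : H →L[ℂ] F}
    (h : ∀ k j, T ((V ^ k) (gen e j)) = 0) : T = 0 := by
  have h1 : T† = 0 := by
    ext y
    refine hV.eq_zero_of_forall_inner fun k a => ?_
    rw [ContinuousLinearMap.adjoint_inner_right, emb_eq_sum]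
    simp only [map_sum, map_smul, h, smul_zero, Finset.sum_const_zero, inner_zero_left]
  rw [← ContinuousLinearMap.adjoint_adjoint T, h1, map_zero]

end IsShift

theorem exists_natDegree_le (P : Matrix (Fin m) (Fin m) ℂ[X]) :
    ∃ d, ∀ i j, (P i j).natDegree ≤ d := by
  refine ⟨∑ i, ∑ j, (P i j).natDegree, fun i j => ?_⟩
  exact (Finset.single_le_sum_of_canonicallyOrdered (f := fun j => (P i j).natDegree)
    (Finset.mem_univ j)).trans (Finset.single_le_sum_of_canonicallyOrdered
      (f := fun i => ∑ j, (P i j).natDegree) (Finset.mem_univ i))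

/-- The operator `S`, commuting with `V`, is multiplication by the rational matrix function
`P / q`. -/
def HasSymbol (V : H →L[ℂ] H) (e : EuclideanSpace ℂ (Fin m) →L[ℂ] H) (S : H →L[ℂ] H)
    (q : ℂ[X]) (P : Matrix (Fin m) (Fin m) ℂ[X]) : Prop :=
  ∀ j, aeval V q (S (gen e j)) = ∑ i, aeval V (P i j) (gen e i)

theorem IsUnitaryExtension.adj_adj (hNJ : ∀ x, N (J x) = J (S x)) (z : K) :
    (J†) ((N†) z) = (S†) ((J†) z) := by
  have h1 : N ∘L J = J ∘L S := ContinuousLinearMap.ext hNJ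
  have h2 := congrArg ContinuousLinearMap.adjoint h1
  rw [ContinuousLinearMap.adjoint_comp, ContinuousLinearMap.adjoint_comp] at h2
  exact congrArg (· z) h2

theorem IsUnitaryExtension.commute_adjoint_aeval (hU : IsUnitaryExtension V J U)
    (hN : Commute N U) (p : ℂ[X]) : Commute N ((aeval U p)†) := by
  have := (commute_aeval (hU.commute_star hN) p).star_star
  rwa [star_star] at this

section

variable (hV : IsShift V e) (hU : IsUnitaryExtension V J U) (hN : Commute N U)
  (hNJ : ∀ x, N (J x) = J (S x)) {q : ℂ[X]} {P : Matrix (Fin m) (Fin m) ℂ[X]}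
  (hP : HasSymbol V e S q P)

include hU hN hNJ hP in
theorem HasSymbol.apply_incl (j : Fin m) :
    aeval U q (N (J (gen e j))) = ∑ i, aeval U (P i j) (J (gen e i)) := by
  rw [hNJ, hU.aeval_incl, hP j, map_sum]
  simp only [hU.aeval_incl]

include hV hU hN hNJ hP in
-- `N†` acts by the conjugate transpose of the symbol. Since `N†` need not preserve `J H`, this is
-- checked weakly, by moving adjoints onto the translates of the wandering vectors.
theorem HasSymbol.adj_apply_incl (j : Fin m) :
    ((aeval U q)†) ((N†) (J (gen e j))) = ∑ i, ((aeval U (P j i))†) (J (gen e i)) := by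
  rw [← sub_eq_zero]
  refine hU.eq_zero_of_forall_inner hV fun k n a => ?_
  rw [emb_eq_sum, map_sum, map_sum, sum_inner]
  refine Finset.sum_eq_zero fun l _ => ?_
  rw [map_smul, map_smul, inner_smul_left]
  refine mul_eq_zero_of_right _ ?_
  have hcomm : ∀ (p : ℂ[X]) (z : K), (U ^ n) (((aeval U p)†) z) = ((aeval U p)†) ((U ^ n) z) :=
    fun p z => commute_apply
      ((hU.commute_adjoint_aeval (Commute.refl U) p).pow_left n) z
  have hcomm' : ∀ z : K, (U ^ n) ((N†) z) = (N†) ((U ^ n) z) := fun z =>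
    (commute_apply ((hU.commute_star hN).pow_right n) z).symm
  have hcomm2 : ∀ (p : ℂ[X]) (z : K), aeval U p ((U ^ k) z) = (U ^ k) (aeval U p z) :=
    fun p z => commute_apply ((commute_aeval (Commute.refl U) p).symm.pow_right k) z
  have hkey : ∀ (p : ℂ[X]) (i j : Fin m),
      ⟪(U ^ k) (aeval U p (J (gen e i))), (U ^ n) (J (gen e j))⟫_ℂ =
        if i = j then starRingEnd ℂ ((X ^ k * p).coeff n) else 0 := by
    intro p i j
    rw [← hV.inner_aeval_gen, ← hU.inner_incl, ← hU.pow_incl, ← hU.aeval_incl,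
      aeval_mul_apply, map_pow, aeval_X]
  rw [map_sub, inner_sub_right, map_sum, inner_sum, hcomm, hcomm',
    ContinuousLinearMap.adjoint_inner_right, ContinuousLinearMap.adjoint_inner_right, hcomm2,
    commute_apply (hN.pow_right k), commute_apply (commute_aeval hN q),
    hP.apply_incl hU hN hNJ, map_sum, sum_inner]
  simp only [hcomm, ContinuousLinearMap.adjoint_inner_right, hcomm2, hkey]
  simp

include hV hU hN hNJ hP in
-- Multiplying `F* F - F F*` by `q`, by the conjugate of `q` and by the `d`-th power of the variable
-- clears all denominators and conjugates, leaving polynomial entries.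
theorem HasSymbol.commutator_incl {d : ℕ} (hd : ∀ i j, (P i j).natDegree ≤ d) (j : Fin m) :
    (U ^ d) (((aeval U q)†) (aeval U q ((N†) (N (J (gen e j))) - N ((N†) (J (gen e j)))))) =
      J (∑ k, aeval V (∑ i, P i j * revConj d (P i k) - ∑ i, revConj d (P j i) * P k i)
        (gen e k)) := by
  have c1 : ∀ (p : ℂ[X]) (z : K), (U ^ d) (aeval U p z) = aeval U p ((U ^ d) z) := fun p z =>
    commute_apply ((commute_aeval (Commute.refl U) p).pow_left d) z
  have c2 : ∀ (p r : ℂ[X]) (z : K), ((aeval U r)†) (aeval U p z) = aeval U p (((aeval U r)†) z) :=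
    fun p r z => (commute_apply (hU.commute_adjoint_aeval
      (commute_aeval (Commute.refl U) p).symm r) z).symm
  have c3 : ∀ (p : ℂ[X]) (z : K), aeval U p ((N†) z) = (N†) (aeval U p z) := fun p z =>
    (commute_apply (commute_aeval (hU.commute_star hN) p) z).symm
  have c4 : ∀ (p : ℂ[X]) (z : K), ((aeval U p)†) (N z) = N (((aeval U p)†) z) := fun p z =>
    (commute_apply (hU.commute_adjoint_aeval hN p) z).symm
  have c5 : ∀ (p : ℂ[X]) (z : K), aeval U p (N z) = N (aeval U p z) := fun p z =>
    (commute_apply (commute_aeval hN p) z).symm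
  have e1 : (U ^ d) (((aeval U q)†) (aeval U q ((N†) (N (J (gen e j)))))) =
      ∑ k, J (aeval V (∑ i, P i j * revConj d (P i k)) (gen e k)) := by
    rw [c3, hP.apply_incl hU hN hNJ]
    simp only [map_sum, _root_.sum_apply, aeval_mul_apply]
    rw [Finset.sum_comm]
    refine Finset.sum_congr rfl fun i _ => ?_
    rw [← c3, c2, c1, hP.adj_apply_incl hV hU hN hNJ]
    simp only [map_sum]
    refine Finset.sum_congr rfl fun k _ => ?_
    rw [← hU.aeval_revConj (hd i k), hU.aeval_incl, hU.aeval_incl]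
  have e2 : (U ^ d) (((aeval U q)†) (aeval U q (N ((N†) (J (gen e j)))))) =
      ∑ k, J (aeval V (∑ i, revConj d (P j i) * P k i) (gen e k)) := by
    rw [c2, c4, hP.adj_apply_incl hV hU hN hNJ]
    simp only [map_sum, _root_.sum_apply, aeval_mul_apply]
    rw [Finset.sum_comm]
    refine Finset.sum_congr rfl fun i _ => ?_
    rw [← c4, ← c2, hP.apply_incl hU hN hNJ]
    simp only [map_sum]
    refine Finset.sum_congr rfl fun k _ => ?_
    rw [← hU.aeval_revConj (hd j i), hU.aeval_incl, hU.aeval_incl]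
  rw [map_sub, map_sub, map_sub, e1, e2, ← Finset.sum_sub_distrib, map_sum]
  refine Finset.sum_congr rfl fun k _ => ?_
  rw [map_sub, _root_.sub_apply, map_sub]

include hV hU hN hNJ hP in
/-- The extension of an operator with rational symbol `P / q` is normal if and only if the
boundary values of the symbol are normal, the latter being written as polynomial identities. -/
theorem HasSymbol.isStarNormal_iff (hq : q ≠ 0) {d : ℕ} (hd : ∀ i j, (P i j).natDegree ≤ d) :
    IsStarNormal N ↔
      ∀ j k, ∑ i, P i j * revConj d (P i k) - ∑ i, revConj d (P j i) * P k i = 0 := by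
  constructor
  · intro hnorm j k
    have h1 := hP.commutator_incl hV hU hN hNJ hd j
    have h2 : (N†) (N (J (gen e j))) = N ((N†) (J (gen e j))) :=
      commute_apply hnorm.star_comm_self _
    rw [h2, sub_self, map_zero, map_zero, map_zero] at h1
    refine hV.polynomial_eq_zero (p := fun k => ∑ i, P i j * revConj d (P i k) -
      ∑ i, revConj d (P j i) * P k i) (hU.incl_injective (y := 0) ?_) k
    rw [map_zero, ← h1]
  · intro hr
    have hcomm : Commute (star N * N - N * star N) U :=
      ((hU.commute_star hN).mul_left hN).sub_left (hN.mul_left (hU.commute_star hN))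
    refine ⟨sub_eq_zero.1 (hU.eq_zero_of_commute hV hcomm fun a => ?_)⟩
    rw [emb_eq_sum, map_sum, map_sum]
    refine Finset.sum_eq_zero fun j _ => ?_
    rw [map_smul, map_smul]
    refine smul_eq_zero_of_right _ ?_
    have h1 := hP.commutator_incl hV hU hN hNJ hd j
    simp only [hr] at h1
    simp only [map_zero, _root_.zero_apply, Finset.sum_const_zero] at h1
    have h2 := hU.adj_pow_pow d (((aeval U q)†) (aeval U q
      ((N†) (N (J (gen e j))) - N ((N†) (J (gen e j))))))
    rw [h1, map_zero] at h2
    -- Both denominators are cancelled: `q(U)` directly, and its adjoint after a power of `U` turns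
    -- it into `(revConj _ q)(U)`.
    refine hU.aeval_injective hV hq (hU.aeval_injective hV (revConj_ne_zero le_rfl hq) ?_)
    rw [hU.aeval_revConj le_rfl]
    refine (congrArg (U ^ q.natDegree) h2.symm).trans (map_zero _)

theorem adj_incl_eq_of_mem_range (hU : IsUnitaryExtension V J U) (hNJ : ∀ x, N (J x) = J (S x))
    {x y : H} (h : (N†) (J x) = J y) : (N†) (J x) = J ((S†) x) := by
  have h1 := IsUnitaryExtension.adj_adj hNJ (J x)
  rw [hU.adj_incl, h, hU.adj_incl] at h1
  rw [h, h1]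

include hU hNJ in
-- `S† x` is the projection of `N† (J x)` to `H`. Normality of `N` makes the squared distance `‖N†
-- (J x)‖² - ‖S† x‖²` equal to `‖S x‖² - ‖S† x‖²`, the quadratic form of the self-commutator.
theorem selfCommutator_apply_eq_zero_iff (hnorm : IsStarNormal N) (x : H) :
    selfCommutator S x = 0 ↔ (N†) (J x) = J ((S†) x) := by
  have hS : ∀ y, (S†) y = (J†) ((N†) (J y)) := fun y => by
    rw [IsUnitaryExtension.adj_adj hNJ, hU.adj_incl]
  have hC : selfCommutator S x = (S†) (S x) - S ((S†) x) := rfl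
  have hcomm : ∀ z, (N†) (N z) = N ((N†) z) := commute_apply hnorm.star_comm_self
  constructor
  · intro h
    have h1 : ‖(N†) (J x)‖ ^ 2 = ‖(S†) x‖ ^ 2 := by
      have h2 : ⟪(N†) (J x), (N†) (J x)⟫_ℂ = ⟪(S†) x, (S†) x⟫_ℂ := by
        rw [ContinuousLinearMap.adjoint_inner_right, ← hcomm,
          ContinuousLinearMap.adjoint_inner_left, hNJ, hU.inner_incl,
          ContinuousLinearMap.adjoint_inner_right, ← sub_eq_zero.1 (hC.symm.trans h),
          ContinuousLinearMap.adjoint_inner_left]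
      rw [inner_self_eq_norm_sq_to_K, inner_self_eq_norm_sq_to_K] at h2
      exact_mod_cast h2
    have h3 := hU.norm_sub_proj_sq ((N†) (J x))
    rw [← hS, h1] at h3
    have h4 : ‖(N†) (J x) - J ((S†) x)‖ = 0 := by
      have : ‖(N†) (J x) - J ((S†) x)‖ ^ 2 = 0 := by linarith
      exact pow_eq_zero_iff (two_ne_zero) |>.1 this
    exact sub_eq_zero.1 (norm_eq_zero.1 h4)
  · intro h
    rw [hC, sub_eq_zero, hS, ← hNJ, hcomm, h, hNJ, hU.adj_incl]

theorem isSelfAdjoint_selfCommutator (S : H →L[ℂ] H) : (selfCommutator S)† = selfCommutator S := by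
  rw [selfCommutator, map_sub, ContinuousLinearMap.adjoint_comp, ContinuousLinearMap.adjoint_comp,
    ContinuousLinearMap.adjoint_adjoint]

include hV hU hN hNJ hP in
-- With `r = revConj d q`, the factor `r(U) = U ^ d q(U)†` clears the denominator of the adjoint
-- symbol, so `N†` maps `J r(V) H` into `J H`. Thus the self-commutator kills the range of `r(V)`
-- and, being self-adjoint, has its range in the finite-dimensional kernel of `r(V)†`.
theorem HasSymbol.finiteDimensional_range (hq : q ≠ 0) (hnorm : IsStarNormal N) :
    FiniteDimensional ℂ (selfCommutator S).range := by
  obtain ⟨d₀, hd₀⟩ := exists_natDegree_le P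
  obtain ⟨d, hdq, hd⟩ : ∃ d, q.natDegree ≤ d ∧ ∀ i j, (P i j).natDegree ≤ d :=
    ⟨max q.natDegree d₀, le_max_left _ _, fun i j => (hd₀ i j).trans (le_max_right _ _)⟩
  set r := revConj d q with hr
  have hr0 : r ≠ 0 := revConj_ne_zero hdq hq
  have hT : ((1 - J ∘L (J†)) ∘L (N†) ∘L J ∘L aeval V r) = 0 := by
    refine hV.clm_ext_zero fun k j => ?_
    have h1 : (N†) (J (aeval V r ((V ^ k) (gen e j)))) =
        J ((V ^ k) (∑ i, aeval V (revConj d (P j i)) (gen e i))) := by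
      have c1 : ∀ z, (N†) ((U ^ k) z) = (U ^ k) ((N†) z) := fun z =>
        commute_apply ((hU.commute_star hN).pow_right k) z
      have c2 : ∀ z, (N†) ((U ^ d) z) = (U ^ d) ((N†) z) := fun z =>
        commute_apply ((hU.commute_star hN).pow_right d) z
      have c3 : ∀ z, (N†) (((aeval U q)†) z) = ((aeval U q)†) ((N†) z) := fun z =>
        commute_apply (hU.commute_adjoint_aeval (hU.commute_star hN) q) z
      rw [← commute_apply ((commute_aeval (Commute.refl V) r).pow_left k), ← hU.pow_incl,
        ← hU.aeval_incl, hU.aeval_revConj hdq, c1, c2, c3, hP.adj_apply_incl hV hU hN hNJ,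
        ← hU.pow_incl]
      simp only [map_sum]
      refine Finset.sum_congr rfl fun i _ => ?_
      rw [← hU.aeval_revConj (hd j i), hU.aeval_incl]
    simp only [ContinuousLinearMap.comp_apply, h1, _root_.sub_apply, one_apply_eq_self,
      hU.adj_incl, sub_self]
  have hC : selfCommutator S ∘L aeval V r = 0 := by
    ext x
    refine (selfCommutator_apply_eq_zero_iff hU hNJ hnorm _).2 ?_
    refine adj_incl_eq_of_mem_range hU hNJ (y := (J†) ((N†) (J (aeval V r x)))) ?_
    exact sub_eq_zero.1 (congrArg (· x) hT)
  have hC' : (aeval V r)† ∘L selfCommutator S = 0 := by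
    rw [← isSelfAdjoint_selfCommutator S, ← ContinuousLinearMap.adjoint_comp, hC, map_zero]
  have := hU.finiteDimensional_ker_adj_aeval hV hr0
  refine Submodule.finiteDimensional_of_le (S₂ := ((aeval V r)†).ker) ?_
  rintro _ ⟨x, rfl⟩
  exact congrArg (· x) hC'

include hV hU hN hNJ hP in
/-- If `det (P - c q)` is not the zero polynomial, then `c` is not an eigenvalue of the normal
extension. -/
theorem HasSymbol.eq_zero_of_eigen (hnorm : IsStarNormal N) {c : ℂ}
    (hdet : (P - (C c * q) • (1 : Matrix (Fin m) (Fin m) ℂ[X])).det ≠ 0) {z : K}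
    (hz : N z = c • z) : z = 0 := by
  set B := P - (C c * q) • (1 : Matrix (Fin m) (Fin m) ℂ[X]) with hB
  set δ := B.det with hδ
  have hBj : ∀ j, aeval U q (N (J (gen e j)) - c • J (gen e j)) =
      ∑ i, aeval U (B i j) (J (gen e i)) := by
    intro j
    rw [map_sub, hP.apply_incl hU hN hNJ, map_smul]
    simp only [hB, Matrix.sub_apply, Matrix.smul_apply, Matrix.one_apply, map_sub,
      _root_.sub_apply, Finset.sum_sub_distrib, smul_eq_mul, mul_ite, mul_one, mul_zero]
    congr 1
    rw [Finset.sum_eq_single j]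
    · rw [if_pos rfl, aeval_mul_apply, aeval_C, Algebra.algebraMap_eq_smul_one]; rfl
    · intro i _ hij; rw [if_neg hij]; simp
    · simp
  -- From `B * adjugate B = δ`: the witness `y` is the `l`-th column of the adjugate, multiplied by
  -- `q`.
  have hδl : ∀ l, ∃ y, aeval U δ (J (gen e l)) = N y - c • y := by
    intro l
    refine ⟨∑ j, aeval U (B.adjugate j l) (aeval U q (J (gen e j))), ?_⟩
    have h1 : ∀ j, N (aeval U (B.adjugate j l) (aeval U q (J (gen e j)))) -
        c • (aeval U (B.adjugate j l) (aeval U q (J (gen e j)))) =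
        ∑ i, aeval U (B.adjugate j l * B i j) (J (gen e i)) := by
      intro j
      simp only [aeval_mul_apply]
      rw [← map_sum, ← hBj, commute_apply (commute_aeval hN _), commute_apply (commute_aeval hN _),
        ← map_smul, ← map_smul, ← map_sub, ← map_sub]
    rw [map_sum, Finset.smul_sum, ← Finset.sum_sub_distrib, Finset.sum_congr rfl fun j _ => h1 j,
      Finset.sum_comm]
    have h2 : ∀ i, ∑ j, aeval U (B.adjugate j l * B i j) (J (gen e i)) =
        aeval U ((B * B.adjugate) i l) (J (gen e i)) := by
      intro i
      rw [Matrix.mul_apply, map_sum, _root_.sum_apply]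
      simp only [mul_comm]
    simp only [h2, Matrix.mul_adjugate, Matrix.smul_apply, Matrix.one_apply]
    rw [Finset.sum_eq_single l]
    · simp [hδ]
    · intro i _ hij; rw [if_neg hij]; simp
    · simp
  have hz' : (N†) z = starRingEnd ℂ c • z := by
    have hn : IsStarNormal (N - c • (1 : K →L[ℂ] K)) := by
      refine ⟨?_⟩
      have h1 : Commute (star N) N := hnorm.star_comm_self
      rw [star_sub, star_smul, star_one]
      refine Commute.sub_left (h1.sub_right ((Commute.one_right _).smul_right c)) ?_
      exact ((Commute.one_left _).smul_left _)
    have h2 := (ContinuousLinearMap.IsStarNormal.adjoint_apply_eq_zero_iff hn z).2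
      (sub_eq_zero.2 hz)
    rw [map_sub, map_smulₛₗ, ContinuousLinearMap.adjoint_one] at h2
    exact sub_eq_zero.1 h2
  have hU' : ∀ n : ℕ, (N†) ((U ^ n) z) = starRingEnd ℂ c • (U ^ n) z := fun n => by
    have : (N†) ((U ^ n) z) = (U ^ n) ((N†) z) :=
      commute_apply ((hU.commute_star hN).pow_right n) z
    rw [this, hz', map_smul]
  -- All `U ^ n z` are eigenvectors of `N†` for the conjugate of `c`, hence orthogonal to the range
  -- of `N - c`.
  have hort : ∀ (n : ℕ) (y : K), ⟪N y - c • y, (U ^ n) z⟫_ℂ = 0 := by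
    intro n y
    rw [inner_sub_left, ← ContinuousLinearMap.adjoint_inner_right, hU', inner_smul_left,
      inner_smul_right, sub_self]
  have hfin : ((aeval U δ)†) z = 0 := by
    refine hU.eq_zero_of_forall_inner hV fun k n a => ?_
    rw [emb_eq_sum, map_sum, map_sum, sum_inner]
    refine Finset.sum_eq_zero fun l _ => ?_
    rw [map_smul, map_smul, inner_smul_left]
    refine mul_eq_zero_of_right _ ?_
    obtain ⟨y, hy⟩ := hδl l
    have c1 : (U ^ n) (((aeval U δ)†) z) = ((aeval U δ)†) ((U ^ n) z) :=
      commute_apply ((hU.commute_adjoint_aeval (Commute.refl U) δ).pow_left n) z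
    rw [c1, ContinuousLinearMap.adjoint_inner_right,
      ← commute_apply ((commute_aeval (Commute.refl U) δ).pow_left k), hy, map_sub, map_smul,
      ← commute_apply (hN.pow_right k), hort]
  refine hU.aeval_injective hV (revConj_ne_zero le_rfl hdet) ?_
  rw [hU.aeval_revConj le_rfl, hfin, map_zero]

end

end Symbol

/-! ### Finite-rank self-commutator implies a normal extension and a rational symbol. -/

section FiniteRank

variable {H K : Type*}
  [NormedAddCommGroup H] [InnerProductSpace ℂ H] [CompleteSpace H]
  [NormedAddCommGroup K] [InnerProductSpace ℂ K] [CompleteSpace K]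
  {m : ℕ} {V : H →L[ℂ] H} {e : EuclideanSpace ℂ (Fin m) →L[ℂ] H}
  {J : H →L[ℂ] K} {U : K →L[ℂ] K} {S : H →L[ℂ] H} {N : K →L[ℂ] K}

theorem IsShift.tendsto_inner_pow (hV : IsShift V e) (x y : H) :
    Tendsto (fun n : ℕ => ⟪y, (V ^ n) x⟫_ℂ) atTop (𝓝 0) := by
  have h1 : Tendsto (fun n : ℕ => ⟪((V†) ^ n) y, x⟫_ℂ) atTop (𝓝 ⟪(0 : H), x⟫_ℂ) :=
    (hV.tendsto y).inner tendsto_const_nhds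
  rw [inner_zero_left] at h1
  refine h1.congr fun n => ?_
  rw [← adjoint_pow, ContinuousLinearMap.adjoint_inner_left]

/-- `V ^ n x` tends weakly to zero, and the quadratic form of a finite-rank operator is a finite sum
of products of such inner products. -/
theorem IsShift.tendsto_inner_of_finiteDimensional (hV : IsShift V e) {C : H →L[ℂ] H}
    (hC : C† = C) [FiniteDimensional ℂ C.range] (x : H) :
    Tendsto (fun n : ℕ => ⟪(V ^ n) x, C ((V ^ n) x)⟫_ℂ) atTop (𝓝 0) := by
  let b := stdOrthonormalBasis ℂ C.range
  have h1 : ∀ y, C y = ∑ i, ⟪C (b i : H), y⟫_ℂ • (b i : H) := by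
    intro y
    have h2 := congrArg Subtype.val (b.sum_repr' (⟨C y, ⟨y, rfl⟩⟩ : C.range))
    rw [Submodule.coe_sum] at h2
    refine h2.symm.trans (Finset.sum_congr rfl fun i _ => ?_)
    rw [Submodule.coe_smul, Submodule.coe_inner]
    congr 1
    rw [← ContinuousLinearMap.adjoint_inner_left, hC]
  have h2 : ∀ n, ⟪(V ^ n) x, C ((V ^ n) x)⟫_ℂ =
      ∑ i, ⟪C (b i : H), (V ^ n) x⟫_ℂ * starRingEnd ℂ ⟪(b i : H), (V ^ n) x⟫_ℂ := by
    intro n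
    rw [h1 ((V ^ n) x), inner_sum]
    refine Finset.sum_congr rfl fun i _ => ?_
    rw [inner_smul_right, inner_conj_symm]
  simp only [h2]
  have h3 : (0 : ℂ) = ∑ i : Fin (Module.finrank ℂ C.range), 0 * starRingEnd ℂ 0 := by simp
  rw [h3]
  refine tendsto_finsetSum _ fun i _ => (hV.tendsto_inner_pow _ _).mul ?_
  exact (Complex.continuous_conj.tendsto 0).comp (hV.tendsto_inner_pow x (b i : H))

section

variable (hV : IsShift V e) (hU : IsUnitaryExtension V J U) (hN : Commute N U)
  (hNJ : ∀ x, N (J x) = J (S x))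

include hV hU hN hNJ in
-- Replacing `x` by `V ^ n x` changes neither norm. The difference of squares is then the
-- self-commutator form at `V ^ n x` minus the squared distance of `U ^ n (N† (J x))` from `J H`,
-- and both tend to zero.
theorem norm_apply_incl_eq_of_finiteDimensional
    [FiniteDimensional ℂ (selfCommutator S).range] (x : H) :
    ‖N (J x)‖ = ‖(N†) (J x)‖ := by
  have c1 : ∀ (n : ℕ) z, (N†) ((U ^ n) z) = (U ^ n) ((N†) z) := fun n z =>
    commute_apply ((hU.commute_star hN).pow_right n) z
  have c2 : ∀ (n : ℕ) z, N ((U ^ n) z) = (U ^ n) (N z) := fun n z =>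
    commute_apply (hN.pow_right n) z
  have h1 : ∀ n : ℕ, ‖N (J x)‖ ^ 2 - ‖(N†) (J x)‖ ^ 2 =
      RCLike.re ⟪(V ^ n) x, selfCommutator S ((V ^ n) x)⟫_ℂ -
        ‖(U ^ n) ((N†) (J x)) - J ((J†) ((U ^ n) ((N†) (J x))))‖ ^ 2 := by
    intro n
    set y := (V ^ n) x with hy
    have e1 : ‖N (J x)‖ = ‖S y‖ := by
      rw [← hU.norm_pow_apply n, ← c2, hU.pow_incl, hNJ, hU.norm_incl]
    have e2 : ‖(N†) (J x)‖ ^ 2 = ‖(S†) y‖ ^ 2 +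
        ‖(U ^ n) ((N†) (J x)) - J ((J†) ((U ^ n) ((N†) (J x))))‖ ^ 2 := by
      rw [← hU.norm_pow_apply n, hU.norm_sub_proj_sq]
      have : (J†) ((U ^ n) ((N†) (J x))) = (S†) y := by
        rw [← c1, hU.pow_incl, IsUnitaryExtension.adj_adj hNJ, hU.adj_incl]
      rw [this]
    have e3 : RCLike.re ⟪y, selfCommutator S y⟫_ℂ = ‖S y‖ ^ 2 - ‖(S†) y‖ ^ 2 := by
      have : selfCommutator S y = (S†) (S y) - S ((S†) y) := rfl
      rw [this, inner_sub_right, ContinuousLinearMap.adjoint_inner_right,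
        ← ContinuousLinearMap.adjoint_inner_left S ((S†) y) y, inner_self_eq_norm_sq_to_K,
        inner_self_eq_norm_sq_to_K]
      norm_cast
    rw [e1, e2, e3]; ring
  have h2 := (RCLike.continuous_re.tendsto (0 : ℂ)).comp
    (hV.tendsto_inner_of_finiteDimensional (isSelfAdjoint_selfCommutator S) x)
  have h3 := h2.sub ((hU.tendsto ((N†) (J x))).norm.pow 2)
  have h4 := tendsto_nhds_unique (tendsto_const_nhds.congr h1) h3
  rw [norm_zero] at h4
  simp only [map_zero] at h4
  have h5 : ‖N (J x)‖ ^ 2 = ‖(N†) (J x)‖ ^ 2 := by linarith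
  exact (sq_eq_sq₀ (norm_nonneg _) (norm_nonneg _)).1 h5

include hV hU hN hNJ in
-- The norms of `N z` and `N† z` are unchanged when `z` is replaced by `U ^ n z`, which comes
-- arbitrarily close to `J H`, where they agree.
theorem isStarNormal_of_finiteDimensional [FiniteDimensional ℂ (selfCommutator S).range] :
    IsStarNormal N := by
  rw [ContinuousLinearMap.isStarNormal_iff_norm_eq_adjoint]
  intro z
  have c1 : ∀ n : ℕ, ‖(N†) ((U ^ n) z)‖ = ‖(N†) z‖ := fun n => by
    rw [show (N†) ((U ^ n) z) = (U ^ n) ((N†) z) from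
      commute_apply ((hU.commute_star hN).pow_right n) z, hU.norm_pow_apply]
  have c2 : ∀ n : ℕ, ‖N ((U ^ n) z)‖ = ‖N z‖ := fun n => by
    rw [commute_apply (hN.pow_right n) z, hU.norm_pow_apply]
  have h1 : ∀ n : ℕ, |‖N z‖ - ‖(N†) z‖| ≤
      (‖N‖ + ‖N†‖) * ‖(U ^ n) z - J ((J†) ((U ^ n) z))‖ := by
    intro n
    set w := (J†) ((U ^ n) z)
    have h2 := norm_apply_incl_eq_of_finiteDimensional hV hU hN hNJ w
    have h3 : ‖N z‖ - ‖(N†) z‖ = (‖N ((U ^ n) z)‖ - ‖N (J w)‖) +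
        (‖(N†) (J w)‖ - ‖(N†) ((U ^ n) z)‖) := by rw [c1, c2, h2]; ring
    have h4 : |‖N ((U ^ n) z)‖ - ‖N (J w)‖| ≤ ‖N‖ * ‖(U ^ n) z - J w‖ := by
      refine (abs_norm_sub_norm_le _ _).trans ?_
      rw [← map_sub]; exact N.le_opNorm _
    have h5 : |‖(N†) (J w)‖ - ‖(N†) ((U ^ n) z)‖| ≤ ‖N†‖ * ‖(U ^ n) z - J w‖ := by
      refine (abs_norm_sub_norm_le _ _).trans ?_
      rw [← map_sub, norm_sub_rev ((U ^ n) z)]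
      exact (N†).le_opNorm _
    rw [h3, add_mul]
    exact (abs_add_le _ _).trans (add_le_add h4 h5)
  have h6 := ((hU.tendsto z).norm).const_mul (‖N‖ + ‖N†‖)
  rw [norm_zero, mul_zero] at h6
  have h7 := ge_of_tendsto' h6 h1
  exact sub_eq_zero.1 (abs_eq_zero.1 (le_antisymm h7 (abs_nonneg _)))

theorem adjoint_aeval (A : H →L[ℂ] H) (p : ℂ[X]) :
    (aeval A p)† = aeval (A†) (p.map (starRingEnd ℂ)) := by
  rw [aeval_eq_sum_range, aeval_eq_sum_range, natDegree_map, map_sum]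
  refine Finset.sum_congr rfl fun k _ => ?_
  rw [map_smulₛₗ, adjoint_pow, coeff_map]

include hU hN hNJ in
-- The kernel consists of the `x` with `N† (J x)` in `J H`, and `N†` commutes with `U`, which
-- extends `V`.
theorem shift_mem_ker_selfCommutator (hnorm : IsStarNormal N) {x : H}
    (hx : selfCommutator S x = 0) :
    selfCommutator S (V x) = 0 ∧ (S†) (V x) = V ((S†) x) := by
  have h1 := (selfCommutator_apply_eq_zero_iff hU hNJ hnorm x).1 hx
  have h2 : (N†) (J (V x)) = J (V ((S†) x)) := by
    rw [← hU.incl, show (N†) (U (J x)) = U ((N†) (J x)) from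
      commute_apply (hU.commute_star hN) _, h1, hU.incl]
  have h3 := adj_incl_eq_of_mem_range hU hNJ h2
  exact ⟨(selfCommutator_apply_eq_zero_iff hU hNJ hnorm _).2 h3,
    hU.incl_injective (h3.symm.trans h2)⟩

include hV hU hN hNJ in
/-- If the self-commutator of `S` has finite rank, then the symbol of `S` is rational. -/
theorem exists_hasSymbol_of_finiteDimensional [FiniteDimensional ℂ (selfCommutator S).range] :
    ∃ (q : ℂ[X]) (P : Matrix (Fin m) (Fin m) ℂ[X]), q ≠ 0 ∧ HasSymbol V e S q P := by
  have hnorm := isStarNormal_of_finiteDimensional hV hU hN hNJ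
  set L : Submodule ℂ H := ((selfCommutator S).ker)ᗮ with hL
  have hLfin : FiniteDimensional ℂ L := by
    have : L = (selfCommutator S).range := by
      rw [hL, ContinuousLinearMap.orthogonal_ker, isSelfAdjoint_selfCommutator]
      exact (Submodule.closed_of_finiteDimensional _).submodule_topologicalClosure_eq
    rw [this]; infer_instance
  have hVL : ∀ x ∈ L, (V†) x ∈ L := by
    intro x hx
    rw [hL, Submodule.mem_orthogonal] at hx ⊢
    intro y hy
    rw [ContinuousLinearMap.adjoint_inner_right]
    exact hx _ (shift_mem_ker_selfCommutator hU hN hNJ hnorm hy).1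
  have hSL : ∀ j, (V†) (S (gen e j)) ∈ L := by
    intro j
    rw [hL, Submodule.mem_orthogonal]
    intro y hy
    rw [ContinuousLinearMap.adjoint_inner_right, ← ContinuousLinearMap.adjoint_inner_left,
      (shift_mem_ker_selfCommutator hU hN hNJ hnorm hy).2, gen, ← inner_conj_symm,
      hV.inner_emb_apply, map_zero]
  let f : L →ₗ[ℂ] L := ((V†) : H →ₗ[ℂ] H).restrict hVL
  have hf : ∀ (k : ℕ) (x : L), (((f ^ k) x : L) : H) = ((V†) ^ k) (x : H) := by
    intro k x
    induction k with
    | zero => simp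
    | succ k ih =>
      rw [pow_succ_apply', ← ih, pow_succ']
      rfl
  -- By Cayley–Hamilton `p(V†)` kills `L`, so the Taylor coefficients of its elements satisfy one
  -- linear recurrence: these functions are rational.
  set p := f.charpoly with hp
  have hp0 : p ≠ 0 := f.charpoly_monic.ne_zero
  have hpL : ∀ x ∈ L, aeval (V†) p x = 0 := by
    intro x hx
    have h1 := congrArg (fun g : L →ₗ[ℂ] L => ((g ⟨x, hx⟩ : L) : H)) f.aeval_self_charpoly
    simp only [aeval_eq_sum_range, LinearMap.sum_apply, LinearMap.smul_apply, Submodule.coe_sum,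
      Submodule.coe_smul, hf] at h1
    rw [aeval_eq_sum_range]
    simp only [_root_.sum_apply, _root_.smul_apply]
    exact h1
  set r := p.map (starRingEnd ℂ) with hr
  have hr0 : r ≠ 0 := (Polynomial.map_ne_zero_iff (RingHom.injective _)).2 hp0
  have hrp : r.map (starRingEnd ℂ) = p := by
    rw [hr, Polynomial.map_map]
    ext k
    simp
  -- Then `V† ^ deg r * q(V) = r(V)† = p(V†)`, so `q(V)` turns each `V† (S (gen e j))` into a vector
  -- polynomial.
  set q := revConj r.natDegree r with hq
  have hker : ∀ j, ((V†) ^ r.natDegree) (aeval V q ((V†) (S (gen e j)))) = 0 := by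
    intro j
    rw [hq, hV.adj_pow_aeval_revConj le_rfl, adjoint_aeval, hrp, hpL _ (hSL j)]
  choose w hw using fun j => hV.exists_polynomial_of_adj_pow _ (hker j)
  -- The factor `X` undoes the backward shift and the second summand restores the constant term of
  -- `S (gen e j)`.
  refine ⟨q, fun i j => X * w j i + C (((e†) (S (gen e j))) i) * q,
    revConj_ne_zero le_rfl hr0, fun j => ?_⟩
  conv_lhs => rw [← hV.decomp (S (gen e j)), map_add, emb_eq_sum,
    ← commute_apply (commute_aeval (Commute.refl V) q), hw, map_sum, map_sum,
    ← Finset.sum_add_distrib]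
  refine Finset.sum_congr rfl fun i _ => ?_
  rw [map_add, map_mul, aeval_X, map_mul, aeval_C, Algebra.algebraMap_eq_smul_one, map_smul]
  rfl

end

end FiniteRank

/-! ### Wandering subspaces and purity. -/

section Purity

variable {H K : Type*}
  [NormedAddCommGroup H] [InnerProductSpace ℂ H] [CompleteSpace H]
  [NormedAddCommGroup K] [InnerProductSpace ℂ K] [CompleteSpace K]
  {m : ℕ} {V : H →L[ℂ] H} {e : EuclideanSpace ℂ (Fin m) →L[ℂ] H}
  {J : H →L[ℂ] K} {U : K →L[ℂ] K} {S : H →L[ℂ] H} {N : K →L[ℂ] K}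

theorem IsShift.inner_pow_wandering (hV : IsShift V e) {W : Submodule ℂ H}
    (hW : ∀ x ∈ W, ∀ y ∈ W, ∀ k : ℕ, ⟪(V ^ (k + 1)) x, y⟫_ℂ = 0) {x y : H} (hx : x ∈ W)
    (hy : y ∈ W) (k l : ℕ) :
    ⟪(V ^ k) x, (V ^ l) y⟫_ℂ = if k = l then ⟪x, y⟫_ℂ else 0 := by
  rcases lt_trichotomy k l with h | rfl | h
  · obtain ⟨d, rfl⟩ := Nat.exists_eq_add_of_lt h
    rw [add_assoc, pow_add, mul_apply_eq_comp, hV.inner_pow_pow, ← inner_conj_symm, hW y hy x hx,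
      if_neg (by omega), map_zero]
  · rw [hV.inner_pow_pow, if_pos rfl]
  · obtain ⟨d, rfl⟩ := Nat.exists_eq_add_of_lt h
    rw [add_assoc, pow_add, mul_apply_eq_comp, hV.inner_pow_pow, hW x hx y hy,
      if_neg (by omega)]

/-- An orthonormal family in a wandering subspace of the shift of multiplicity `m` has at most
`m` elements. -/
theorem IsShift.card_le_of_wandering (hV : IsShift V e) {W : Submodule ℂ H}
    (hW : ∀ x ∈ W, ∀ y ∈ W, ∀ k : ℕ, ⟪(V ^ (k + 1)) x, y⟫_ℂ = 0) {n : ℕ} {w : Fin n → H}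
    (hw : Orthonormal ℂ w) (hwW : ∀ i, w i ∈ W) : n ≤ m := by
  have hv : Orthonormal ℂ (fun a : ℕ × Fin n => (V ^ a.1) (w a.2)) := by
    rw [orthonormal_iff_ite] at hw ⊢
    rintro ⟨k, i⟩ ⟨l, j⟩
    rw [hV.inner_pow_wandering hW (hwW i) (hwW j), hw]
    simp only [Prod.mk.injEq]
    split_ifs <;> simp_all
  -- Taylor coefficients are counted twice. Bessel's inequality for `V ^ L (gen e j)` against the
  -- orthonormal `V ^ (L - k) (w i)` bounds the share of each `j` by 1; as `L` grows, each unit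
  -- vector `w i` contributes 1 in total.
  have hbound : ∀ L : ℕ, ∑ i, ∑ k ∈ Finset.range (L + 1), ‖(e†) (((V†) ^ k) (w i))‖ ^ 2 ≤ m := by
    intro L
    have h1 : ∀ j : Fin m, ∑ i, ∑ k ∈ Finset.range (L + 1),
        ‖⟪(V ^ k) (gen e j), w i⟫_ℂ‖ ^ 2 ≤ 1 := by
      intro j
      have h2 := hv.sum_inner_products_le (s := Finset.range (L + 1) ×ˢ Finset.univ)
        ((V ^ L) (gen e j))
      rw [hV.norm_pow_apply, gen, hV.norm_emb, PiLp.norm_single, norm_one, one_pow,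
        Finset.sum_product, Finset.sum_comm] at h2
      refine le_trans (le_of_eq (Finset.sum_congr rfl fun i _ => ?_)) h2
      rw [← Finset.sum_range_reflect]
      refine Finset.sum_congr rfl fun k hk => ?_
      have hkL := Finset.mem_range.1 hk
      rw [Nat.add_sub_cancel, norm_inner_symm, ← hV.inner_pow_pow k, ← mul_apply_eq_comp (V ^ k),
        ← pow_add, show k + (L - k) = L by omega]
      rfl
    calc ∑ i, ∑ k ∈ Finset.range (L + 1), ‖(e†) (((V†) ^ k) (w i))‖ ^ 2
        = ∑ i, ∑ k ∈ Finset.range (L + 1), ∑ j, ‖⟪(V ^ k) (gen e j), w i⟫_ℂ‖ ^ 2 := by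
          refine Finset.sum_congr rfl fun i _ => Finset.sum_congr rfl fun k _ => ?_
          rw [EuclideanSpace.norm_sq_eq]
          refine Finset.sum_congr rfl fun j _ => ?_
          rw [← ContinuousLinearMap.adjoint_inner_right, adjoint_pow, gen,
            ← ContinuousLinearMap.adjoint_inner_right, EuclideanSpace.inner_single_left]
          simp
      _ = ∑ j, ∑ i, ∑ k ∈ Finset.range (L + 1), ‖⟪(V ^ k) (gen e j), w i⟫_ℂ‖ ^ 2 := by
          conv_rhs => rw [Finset.sum_comm]
          exact Finset.sum_congr rfl fun i _ => Finset.sum_comm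
      _ ≤ ∑ _j : Fin m, (1 : ℝ) := Finset.sum_le_sum fun j _ => h1 j
      _ = m := by simp
  have hlim : Tendsto (fun L : ℕ => ∑ i, ∑ k ∈ Finset.range (L + 1),
      ‖(e†) (((V†) ^ k) (w i))‖ ^ 2) atTop (𝓝 (∑ _i : Fin n, (1 : ℝ))) := by
    refine tendsto_finsetSum _ fun i _ => ?_
    have h1 : ∀ L : ℕ, 1 - ‖((V†) ^ (L + 1)) (w i)‖ ^ 2 =
        ∑ k ∈ Finset.range (L + 1), ‖(e†) (((V†) ^ k) (w i))‖ ^ 2 := by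
      intro L
      have := hV.norm_sq_eq_sum (w i) (L + 1)
      rw [hw.1 i] at this
      linarith
    have h2 := (((tendsto_add_atTop_iff_nat 1).2 (hV.tendsto (w i))).norm.pow 2).const_sub 1
    rw [norm_zero] at h2
    simpa using h2.congr h1
  have := le_of_tendsto' hlim hbound
  simp only [Finset.sum_const, Finset.card_univ, Fintype.card_fin, nsmul_eq_mul, mul_one] at this
  exact_mod_cast this

theorem IsShift.finiteDimensional_of_wandering (hV : IsShift V e) {W : Submodule ℂ H}
    (hW : ∀ x ∈ W, ∀ y ∈ W, ∀ k : ℕ, ⟪(V ^ (k + 1)) x, y⟫_ℂ = 0) : FiniteDimensional ℂ W := by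
  by_contra hfin
  have h1 : Cardinal.aleph0 ≤ Module.rank ℂ W := by
    by_contra h
    exact hfin (Module.rank_lt_aleph0_iff.1 (not_le.1 h))
  obtain ⟨s, hs, hli⟩ := le_rank_iff_exists_linearIndependent_finset.1
    ((Cardinal.natCast_le_aleph0 (n := m + 1)).trans h1)
  let X : Submodule ℂ W := Submodule.span ℂ (s : Set W)
  have hX : Module.finrank ℂ X = m + 1 := by
    rw [finrank_span_finset_eq_card hli, hs]
  have : FiniteDimensional ℂ X := FiniteDimensional.span_finset ℂ s
  let b := stdOrthonormalBasis ℂ X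
  have hb : Orthonormal ℂ (fun i => ((b i : W) : H)) := by
    have := b.orthonormal
    rw [orthonormal_iff_ite] at this ⊢
    exact this
  have := hV.card_le_of_wandering hW hb fun i => (b i : W).2
  omega

variable (hV : IsShift V e) (hU : IsUnitaryExtension V J U) (hN : Commute N U)
  (hNJ : ∀ x, N (J x) = J (S x))

/-- The largest subspace of `H` which reduces the normal extension `N`. -/
def reducingPart (J : H →L[ℂ] K) (N : K →L[ℂ] K) : Submodule ℂ H :=
  ⨅ k : ℕ, ((1 - J ∘L (J†)) ∘L ((N†) ^ k) ∘L J).ker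

include hU in
theorem mem_reducingPart_iff {x : H} :
    x ∈ reducingPart J N ↔ ∀ k : ℕ, ∃ y, ((N†) ^ k) (J x) = J y := by
  rw [reducingPart, Submodule.mem_iInf]
  refine forall_congr' fun k => ?_
  rw [LinearMap.mem_ker]
  constructor
  · intro h
    exact ⟨(J†) (((N†) ^ k) (J x)), sub_eq_zero.1 h⟩
  · rintro ⟨y, hy⟩
    change ((N†) ^ k) (J x) - J ((J†) (((N†) ^ k) (J x))) = 0
    rw [hy, hU.adj_incl, sub_self]

theorem isClosed_reducingPart : IsClosed (reducingPart J N : Set H) := by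
  rw [reducingPart, Submodule.coe_iInf]
  exact isClosed_iInter fun k => ContinuousLinearMap.isClosed_ker _

include hU hN in
theorem shift_mem_reducingPart {x : H} (hx : x ∈ reducingPart J N) : V x ∈ reducingPart J N := by
  rw [mem_reducingPart_iff hU] at hx ⊢
  intro k
  obtain ⟨y, hy⟩ := hx k
  refine ⟨V y, ?_⟩
  rw [← hU.incl, ← hU.incl, ← hy]
  exact commute_apply ((hU.commute_star hN).pow_left k) _

include hU hNJ in
theorem apply_mem_reducingPart (hnorm : IsStarNormal N) {x : H} (hx : x ∈ reducingPart J N) :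
    S x ∈ reducingPart J N := by
  rw [mem_reducingPart_iff hU] at hx ⊢
  intro k
  obtain ⟨y, hy⟩ := hx k
  refine ⟨S y, ?_⟩
  rw [← hNJ, ← hNJ, ← hy]
  exact commute_apply (hnorm.star_comm_self.pow_left k) _

include hU hNJ in
theorem adj_mem_reducingPart {x : H} (hx : x ∈ reducingPart J N) :
    (N†) (J x) = J ((S†) x) ∧ (S†) x ∈ reducingPart J N := by
  have hx' := (mem_reducingPart_iff hU).1 hx
  have h1 : (N†) (J x) = J ((S†) x) := by
    obtain ⟨y, hy⟩ := hx' 1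
    rw [pow_one] at hy
    exact adj_incl_eq_of_mem_range hU hNJ hy
  refine ⟨h1, (mem_reducingPart_iff hU).2 fun k => ?_⟩
  obtain ⟨y, hy⟩ := hx' (k + 1)
  exact ⟨y, by rw [← h1, ← pow_succ_apply, hy]⟩

include hU hNJ in
-- `T† x` is the projection of `N† (J x)` to `M`, and normality of both operators gives the two
-- vectors the same norm, so they coincide. Hence `M` reduces `N`.
theorem adj_incl_of_normal_restriction {M : Submodule ℂ H} [CompleteSpace M] {T : M →L[ℂ] M}
    (hnorm : IsStarNormal N) (hT : ∀ x : M, (T x : H) = S x) (hTn : IsStarNormal T) (x : M) :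
    (N†) (J x) = J (((T†) x : M) : H) := by
  have e0 : ‖(T†) x‖ = ‖T x‖ :=
    ((ContinuousLinearMap.isStarNormal_iff_norm_eq_adjoint.1 hTn) x).symm
  have e1 : ‖(N†) (J x)‖ = ‖(T†) x‖ := by
    rw [e0, ← (ContinuousLinearMap.isStarNormal_iff_norm_eq_adjoint.1 hnorm), hNJ, hU.norm_incl,
      ← hT]
    rfl
  have e2 : ⟪(N†) (J x), J (((T†) x : M) : H)⟫_ℂ = ⟪(T†) x, (T†) x⟫_ℂ := by
    rw [ContinuousLinearMap.adjoint_inner_left, hNJ, ← hT, hU.inner_incl, ← Submodule.coe_inner,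
      ContinuousLinearMap.adjoint_inner_left]
  have e3 : ‖(N†) (J x) - J (((T†) x : M) : H)‖ ^ 2 = 0 := by
    rw [@norm_sub_sq ℂ, e2, inner_self_eq_norm_sq_to_K, e1, hU.norm_incl]
    norm_cast
    rw [Submodule.coe_norm]
    ring
  exact sub_eq_zero.1 (norm_eq_zero.1 (pow_eq_zero_iff two_ne_zero |>.1 e3))

include hV hU hN hNJ in
/-- If the normal extension `N` commutes with the unitary extension of a shift of finite
multiplicity and has no eigenvectors, then `S` is pure. -/
theorem isPure_of_no_eigenvectors (hnorm : IsStarNormal N)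
    (heig : ∀ (c : ℂ) (z : K), N z = c • z → z = 0) : IsPure S := by
  intro M _ T hT hTn
  set R := reducingPart J N with hR
  have hMR : M ≤ R := by
    intro x hx
    rw [hR, mem_reducingPart_iff hU]
    intro k
    refine ⟨((((T†) ^ k) ⟨x, hx⟩ : M) : H), ?_⟩
    induction k with
    | zero => simp
    | succ k ih =>
      rw [pow_succ_apply', ih, adj_incl_of_normal_restriction hU hNJ hnorm hT hTn,
        pow_succ_apply']
  suffices hR0 : R = ⊥ by
    rw [hR0] at hMR; exact le_bot_iff.1 hMR
  -- the image of `R` under `V`, described by equations so that it is visibly closed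
  let R' : Submodule ℂ H := (1 - V ∘L (V†)).ker ⊓ R.comap ((V†) : H →ₗ[ℂ] H)
  have hR'mem : ∀ x, x ∈ R' ↔ V ((V†) x) = x ∧ (V†) x ∈ R := by
    intro x
    refine and_congr ?_ Iff.rfl
    change x - V ((V†) x) = 0 ↔ _
    rw [sub_eq_zero, eq_comm]
  have hVR' : ∀ x ∈ R, V x ∈ R' := by
    intro x hx
    rw [hR'mem, hV.adj_apply]
    exact ⟨rfl, hx⟩
  have hR'R : R' ≤ R := by
    intro x hx
    obtain ⟨h1, h2⟩ := (hR'mem x).1 hx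
    rw [← h1]
    exact shift_mem_reducingPart hU hN h2
  have hR'closed : IsClosed (R' : Set H) := by
    refine (ContinuousLinearMap.isClosed_ker _).inter ?_
    exact isClosed_reducingPart.preimage (V†).continuous
  have : CompleteSpace R' := hR'closed.completeSpace_coe
  -- `W` is `R ⊖ V R`. It is wandering because `V ^ (k + 1) W` lies in `V R`, and invariant under
  -- `S` because `N†` maps `J V R` into itself.
  set W : Submodule ℂ H := R'ᗮ ⊓ R with hWdef
  have hSW : ∀ x ∈ W, S x ∈ W := by
    rintro x ⟨hx1, hx2⟩
    refine ⟨?_, apply_mem_reducingPart hU hNJ hnorm hx2⟩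
    rw [SetLike.mem_coe, Submodule.mem_orthogonal] at hx1 ⊢
    intro y hy
    obtain ⟨h1, h2⟩ := (hR'mem y).1 hy
    obtain ⟨h3, h4⟩ := adj_mem_reducingPart hU hNJ h2
    have h5 : (N†) (J y) = J (V ((S†) ((V†) y))) := by
      rw [← h1, ← hU.incl, show (N†) (U (J ((V†) y))) = U ((N†) (J ((V†) y))) from
        commute_apply (hU.commute_star hN) _, h3, hU.incl, h1]
    rw [← hU.inner_incl, ← hNJ, ← ContinuousLinearMap.adjoint_inner_left, h5, hU.inner_incl]
    exact hx1 _ (hVR' _ h4)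
  have hWfin : FiniteDimensional ℂ W := by
    refine hV.finiteDimensional_of_wandering fun x hx y hy k => ?_
    have hk : (V ^ k) x ∈ R := by
      induction k with
      | zero => exact hx.2
      | succ k ih => rw [pow_succ_apply']; exact shift_mem_reducingPart hU hN ih
    rw [pow_succ_apply']
    exact (Submodule.mem_orthogonal _ _).1 hy.1 _ (hVR' _ hk)
  have hW0 : W = ⊥ := by
    by_contra hne
    have : Nontrivial W := Submodule.nontrivial_iff_ne_bot.2 hne
    obtain ⟨c, hc⟩ := Module.End.exists_eigenvalue ((S : H →ₗ[ℂ] H).restrict hSW)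
    obtain ⟨w, hw⟩ := hc.exists_hasEigenvector
    have h1 : S (w : H) = c • (w : H) := congrArg Subtype.val hw.apply_eq_smul
    have h2 : J (w : H) = 0 := heig c _ (by rw [hNJ, h1, map_smul])
    exact hw.2 (Subtype.ext (hU.incl_injective (by rw [h2]; simp)))
  -- Now `R = V R`, so `V†` acts isometrically on `R`, which the convergence of `V† ^ n` to zero
  -- forbids unless `R = 0`.
  have hRR' : R' = R := by
    have := Submodule.sup_orthogonal_inf_of_hasOrthogonalProjection hR'R
    rwa [← hWdef, hW0, sup_bot_eq] at this
  rw [eq_bot_iff]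
  intro x hx
  have hnormx : ∀ y ∈ R, ‖(V†) y‖ = ‖y‖ ∧ (V†) y ∈ R := by
    intro y hy
    rw [← hRR'] at hy
    obtain ⟨h1, h2⟩ := (hR'mem y).1 hy
    exact ⟨by rw [← hV.norm_apply, h1], h2⟩
  have hpow : ∀ n : ℕ, ‖((V†) ^ n) x‖ = ‖x‖ ∧ ((V†) ^ n) x ∈ R := by
    intro n
    induction n with
    | zero => exact ⟨by simp, by simpa using hx⟩
    | succ n ih =>
      rw [pow_succ_apply']
      obtain ⟨h1, h2⟩ := hnormx _ ih.2
      exact ⟨h1.trans ih.1, h2⟩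
  exact hV.eq_zero_of_adj_pow_norm fun n => (hpow n).1

end Purity

/-! ### Uniqueness of power series coefficients. -/

section PowerSeries

variable {F : Type*} [NormedAddCommGroup F] [NormedSpace ℂ F] [CompleteSpace F]

theorem hasFPowerSeriesOnBall_of_bounded {a : ℕ → F} {B : ℝ} (ha : ∀ n, ‖a n‖ ≤ B) :
    HasFPowerSeriesOnBall (fun t : ℂ => ∑' n : ℕ, t ^ n • a n)
      (fun n => ContinuousMultilinearMap.mkPiRing ℂ (Fin n) (a n)) 0 1 := by
  set p : FormalMultilinearSeries ℂ ℂ F :=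
    fun n => ContinuousMultilinearMap.mkPiRing ℂ (Fin n) (a n) with hp
  have hsum : (fun t : ℂ => ∑' n : ℕ, t ^ n • a n) = p.sum := by
    funext t
    simp [FormalMultilinearSeries.sum, hp]
  have hrad : 1 ≤ p.radius := by
    refine p.le_radius_of_bound (r := 1) B fun n => ?_
    rw [hp, ContinuousMultilinearMap.norm_mkPiRing]
    simpa using ha n
  rw [hsum]
  exact (p.hasFPowerSeriesOnBall (zero_lt_one.trans_le hrad)).mono zero_lt_one hrad

theorem coeff_eq_of_eqOn_ball {a b : ℕ → F} {A B : ℝ} (ha : ∀ n, ‖a n‖ ≤ A)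
    (hb : ∀ n, ‖b n‖ ≤ B)
    (h : ∀ t ∈ Metric.ball (0 : ℂ) 1, ∑' n : ℕ, t ^ n • a n = ∑' n : ℕ, t ^ n • b n) (n : ℕ) :
    a n = b n := by
  have h1 := (hasFPowerSeriesOnBall_of_bounded ha).hasFPowerSeriesAt
  have h2 := (hasFPowerSeriesOnBall_of_bounded hb).hasFPowerSeriesAt
  have h3 := (h1.congr (Filter.eventually_of_mem (Metric.ball_mem_nhds 0 one_pos)
    h)).eq_formalMultilinearSeries h2
  have h4 := congrArg (fun p : FormalMultilinearSeries ℂ ℂ F => p n fun _ => 1) h3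
  simpa using h4

end PowerSeries

/-! ### Evaluation on the Hardy space. -/

section Hardy

variable {m : ℕ}

theorem HardySpace.norm_coeff_le (f : HardySpace m) (n : ℕ) : ‖f n‖ ≤ ‖f‖ :=
  lp.norm_apply_le_norm two_ne_zero f n

theorem HardySpace.norm_term_le (f : HardySpace m) (t : ℂ) (n : ℕ) :
    ‖t ^ n • f n‖ ≤ ‖t‖ ^ n * ‖f‖ := by
  rw [norm_smul, norm_pow]
  exact mul_le_mul_of_nonneg_left (f.norm_coeff_le n) (by positivity)

theorem HardySpace.summable_eval (f : HardySpace m) {t : ℂ} (ht : ‖t‖ < 1) :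
    Summable fun n : ℕ => t ^ n • f n :=
  Summable.of_norm_bounded ((summable_geometric_of_lt_one (norm_nonneg t) ht).mul_right _)
    (f.norm_term_le t)

theorem HardySpace.differentiableOn_eval (f : HardySpace m) :
    DifferentiableOn ℂ f.eval (Metric.ball 0 1) := by
  have h := (hasFPowerSeriesOnBall_of_bounded f.norm_coeff_le).differentiableOn
  rwa [show (1 : ENNReal) = ENNReal.ofReal 1 by simp, Metric.eball_ofReal] at h

/-- The evaluation functional at a point of the disc. -/
def evalCLM (m : ℕ) {t : ℂ} (ht : ‖t‖ < 1) : HardySpace m →L[ℂ] EuclideanSpace ℂ (Fin m) :=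
  LinearMap.mkContinuous
    { toFun := fun f => f.eval t
      map_add' := fun f g => by
        rw [HardySpace.eval, HardySpace.eval, HardySpace.eval,
          ← (f.summable_eval ht).tsum_add (g.summable_eval ht)]
        exact tsum_congr fun n => smul_add _ _ _
      map_smul' := fun c f => by
        rw [HardySpace.eval, HardySpace.eval, RingHom.id_apply,
          ← (f.summable_eval ht).tsum_const_smul]
        refine tsum_congr fun n => ?_
        change t ^ n • c • f n = c • t ^ n • f n
        exact smul_comm _ _ _ }
    (1 - ‖t‖)⁻¹ fun f => by
      have h := (hasSum_geometric_of_lt_one (norm_nonneg t) ht).mul_right ‖f‖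
      exact tsum_of_norm_bounded h (f.norm_term_le t)

theorem eval_single_zero (a : EuclideanSpace ℂ (Fin m)) (t : ℂ) :
    HardySpace.eval (lp.single 2 0 a : HardySpace m) t = a := by
  rw [HardySpace.eval, tsum_eq_single 0]
  · simp
  · intro n hn
    rw [lp.single_apply_ne _ _ _ hn, smul_zero]

end Hardy

/-! ### The Kolmogorov–Wold representation as a shift. -/

section KolmogorovWold

variable {m : ℕ} {H : Type*} [NormedAddCommGroup H] [InnerProductSpace ℂ H] [CompleteSpace H]
  {V : H →L[ℂ] H} {R : H ≃ₗᵢ[ℂ] HardySpace m}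

theorem transport_apply (S : H →L[ℂ] H) (f : HardySpace m) :
    transport R S f = R (S (R.symm f)) := rfl

theorem IsKolmogorovWold.eval_shift (hR : IsKolmogorovWold V R) (x : H) {t : ℂ}
    (ht : t ∈ Metric.ball (0 : ℂ) 1) : (R (V x)).eval t = t • (R x).eval t := by
  have h := hR (R x) t ht
  rwa [transport_apply, R.symm_apply_apply] at h

theorem eq_of_eval_eq {x y : H}
    (h : ∀ t ∈ Metric.ball (0 : ℂ) 1, (R x).eval t = (R y).eval t) : x = y := by
  refine R.injective (lp.ext (funext fun n => ?_))
  exact coeff_eq_of_eqOn_ball (R x).norm_coeff_le (R y).norm_coeff_le h n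

/-- The sequence `0, a₀, a₁, …`. -/
def shiftSeq {F : Type*} [Zero F] (a : ℕ → F) : ℕ → F
  | 0 => 0
  | n + 1 => a n

/-- The representation is given by values in the disc; uniqueness of power series turns it into a
statement on coefficients. -/
theorem IsKolmogorovWold.coeff_eq_shiftSeq (hR : IsKolmogorovWold V R) (x : H) (n : ℕ) :
    R (V x) n = shiftSeq (fun k => R x k) n := by
  refine coeff_eq_of_eqOn_ball (a := fun n => R (V x) n)
    (b := shiftSeq fun k => R x k) (R (V x)).norm_coeff_le (B := ‖R x‖)
    (fun n => ?_) (fun t ht => ?_) n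
  · cases n with
    | zero => simp [shiftSeq]
    | succ k => exact (R x).norm_coeff_le k
  · have hs := (R x).summable_eval (t := t) (by simpa using ht)
    have hstep : ∀ n : ℕ, t • t ^ n • R x n = t ^ (n + 1) • shiftSeq (fun k => R x k) (n + 1) :=
      fun n => by rw [pow_succ', mul_smul]; rfl
    have hs' : Summable fun n : ℕ => t ^ n • shiftSeq (fun k => R x k) n := by
      rw [← summable_nat_add_iff 1]
      exact (hs.const_smul t).congr hstep
    refine (hR.eval_shift x ht).trans ?_
    rw [hs'.tsum_eq_zero_add, HardySpace.eval, ← hs.tsum_const_smul, tsum_congr hstep]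
    simp [shiftSeq]

theorem IsKolmogorovWold.coeff_shift_zero (hR : IsKolmogorovWold V R) (x : H) :
    R (V x) 0 = 0 := hR.coeff_eq_shiftSeq x 0

theorem IsKolmogorovWold.coeff_shift_succ (hR : IsKolmogorovWold V R) (x : H) (n : ℕ) :
    R (V x) (n + 1) = R x n := hR.coeff_eq_shiftSeq x (n + 1)

/-- The embedding of `ℂᵐ` in `H` corresponding to the constant functions. -/
def constEmb (R : H ≃ₗᵢ[ℂ] HardySpace m) : EuclideanSpace ℂ (Fin m) →L[ℂ] H :=
  (R.symm.toContinuousLinearEquiv : HardySpace m →L[ℂ] H) ∘L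
    lp.singleContinuousLinearMap ℂ (fun _ : ℕ => EuclideanSpace ℂ (Fin m)) 2 0

theorem constEmb_apply (a : EuclideanSpace ℂ (Fin m)) :
    constEmb R a = R.symm (lp.single 2 0 a) := rfl

theorem IsKolmogorovWold.pow_constEmb (hR : IsKolmogorovWold V R) (n : ℕ)
    (a : EuclideanSpace ℂ (Fin m)) :
    (V ^ n) (constEmb R a) = R.symm (lp.single 2 n a) := by
  induction n with
  | zero => rfl
  | succ n ih =>
    rw [pow_succ_apply', ih, ← R.symm_apply_apply (V _)]
    refine congrArg R.symm (lp.ext (funext fun k => ?_))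
    cases k with
    | zero => rw [hR.coeff_shift_zero, lp.single_apply_ne _ _ _ (by omega)]
    | succ k =>
      rw [hR.coeff_shift_succ, R.apply_symm_apply]
      simp [lp.single_apply, Pi.single_apply]

theorem inner_symm_single (n : ℕ) (a : EuclideanSpace ℂ (Fin m)) (x : H) :
    ⟪R.symm (lp.single 2 n a), x⟫_ℂ = ⟪a, R x n⟫_ℂ := by
  rw [← R.inner_map_map, R.apply_symm_apply, lp.inner_single_left]

theorem adj_constEmb (x : H) : ((constEmb R)†) x = R x 0 := by
  refine ext_inner_left ℂ fun a => ?_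
  rw [ContinuousLinearMap.adjoint_inner_right, constEmb_apply, inner_symm_single]

theorem IsKolmogorovWold.coeff_adj_pow (hR : IsKolmogorovWold V R) (n k : ℕ) (x : H) :
    R (((V†) ^ n) x) k = R x (k + n) := by
  refine ext_inner_left ℂ fun a => ?_
  rw [← inner_symm_single, ← inner_symm_single, ← hR.pow_constEmb, ← adjoint_pow,
    ContinuousLinearMap.adjoint_inner_right, ← hR.pow_constEmb, add_comm, pow_add]
  rfl

theorem norm_sq_eq_tsum (x : H) : ‖x‖ ^ 2 = ∑' n, ‖R x n‖ ^ 2 := by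
  have := lp.norm_rpow_eq_tsum (p := 2) (by simp) (R x)
  simpa using this

theorem IsKolmogorovWold.isShift (hR : IsKolmogorovWold V R) (hV : ∀ x, ‖V x‖ = ‖x‖) :
    IsShift V (constEmb R) := by
  have hadj : ∀ x, (V†) (V x) = x := by
    have := (ContinuousLinearMap.norm_map_iff_adjoint_comp_self V).1 hV
    exact fun x => congrArg (· x) this
  have hcV : ∀ x, ((constEmb R)†) (V x) = 0 := fun x => by rw [adj_constEmb, hR.coeff_shift_zero]
  have hce : ∀ a, ((constEmb R)†) (constEmb R a) = a := fun a => by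
    rw [adj_constEmb, constEmb_apply, R.apply_symm_apply, lp.single_apply_self]
  have hVc : ∀ a, (V†) (constEmb R a) = 0 := by
    intro a
    refine ext_inner_right ℂ fun y => ?_
    rw [ContinuousLinearMap.adjoint_inner_left, ← ContinuousLinearMap.adjoint_inner_right, hcV,
      inner_zero_right, inner_zero_left]
  refine ⟨hadj, hce, fun x => ?_, fun x => ?_⟩
  · have h1 : (V ∘L (V†) + constEmb R ∘L (constEmb R)†) ∘L
        (R.symm.toContinuousLinearEquiv : HardySpace m →L[ℂ] H) =
        (R.symm.toContinuousLinearEquiv : HardySpace m →L[ℂ] H) := by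
      refine lp.ext_continuousLinearMap (by simp) fun n => ?_
      ext1 a
      change V ((V†) (R.symm (lp.single 2 n a))) +
        constEmb R (((constEmb R)†) (R.symm (lp.single 2 n a))) = R.symm (lp.single 2 n a)
      rw [← hR.pow_constEmb]
      cases n with
      | zero =>
        rw [pow_zero, one_apply_eq_self, hVc, hce, map_zero, zero_add]
      | succ n => rw [pow_succ_apply', hadj, hcV, map_zero, add_zero]
    have h2 := congrArg (fun T : HardySpace m →L[ℂ] H => T (R x)) h1
    change V ((V†) (R.symm (R x))) + constEmb R (((constEmb R)†) (R.symm (R x))) =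
      R.symm (R x) at h2
    rwa [R.symm_apply_apply] at h2
  -- The backward shift drops the first coefficients, leaving the tail of a convergent series.
  · have h1 : ∀ n : ℕ, ‖((V†) ^ n) x‖ ^ 2 = ∑' k, ‖R x (k + n)‖ ^ 2 := fun n => by
      rw [norm_sq_eq_tsum (R := R)]
      simp only [hR.coeff_adj_pow]
    have h2 := tendsto_sum_nat_add fun k => ‖R x k‖ ^ 2
    rw [tendsto_zero_iff_norm_tendsto_zero]
    have h3 := (h2.congr fun n => (h1 n).symm).sqrt
    simpa [Real.sqrt_sq] using h3

theorem eval_constEmb (a : EuclideanSpace ℂ (Fin m)) (t : ℂ) :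
    (R (constEmb R a)).eval t = a := by
  rw [constEmb_apply, R.apply_symm_apply, eval_single_zero]

/-- Evaluation of the elements of `H` at a point of the disc. -/
def evalAt (R : H ≃ₗᵢ[ℂ] HardySpace m) {t : ℂ} (ht : ‖t‖ < 1) :
    H →L[ℂ] EuclideanSpace ℂ (Fin m) :=
  evalCLM m ht ∘L (R.toContinuousLinearEquiv : H →L[ℂ] HardySpace m)

theorem evalAt_apply {t : ℂ} (ht : ‖t‖ < 1) (x : H) : evalAt R ht x = (R x).eval t := rfl

theorem evalAt_constEmb {t : ℂ} (ht : ‖t‖ < 1) (a : EuclideanSpace ℂ (Fin m)) :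
    evalAt R ht (constEmb R a) = a := eval_constEmb a t

theorem IsKolmogorovWold.evalAt_pow (hR : IsKolmogorovWold V R) {t : ℂ} (ht : ‖t‖ < 1) (n : ℕ)
    (x : H) : evalAt R ht ((V ^ n) x) = t ^ n • evalAt R ht x := by
  induction n with
  | zero => simp
  | succ n ih =>
    rw [pow_succ_apply', evalAt_apply, hR.eval_shift _ (by simpa using ht), ← evalAt_apply ht, ih,
      smul_smul, pow_succ']

theorem IsKolmogorovWold.evalAt_aeval (hR : IsKolmogorovWold V R) {t : ℂ} (ht : ‖t‖ < 1)
    (p : ℂ[X]) (x : H) : evalAt R ht (aeval V p x) = p.eval t • evalAt R ht x := by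
  rw [aeval_eq_sum_range, _root_.sum_apply, map_sum, eval_eq_sum_range, Finset.sum_smul]
  refine Finset.sum_congr rfl fun k _ => ?_
  rw [_root_.smul_apply, map_smul, hR.evalAt_pow, smul_smul]

end KolmogorovWold

/-! ### Rational symbols and their boundary values. -/

section Boundary

variable {m : ℕ} {F : ℂ → Matrix (Fin m) (Fin m) ℂ} {q : ℂ[X]}
  {P : Matrix (Fin m) (Fin m) ℂ[X]}

/-- On the unit disc, `F` is the quotient of a matrix polynomial and a scalar polynomial. -/
def IsQuotient (F : ℂ → Matrix (Fin m) (Fin m) ℂ) (q : ℂ[X])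
    (P : Matrix (Fin m) (Fin m) ℂ[X]) : Prop :=
  ∀ t ∈ Metric.ball (0 : ℂ) 1, ∀ i j, q.eval t * F t i j = (P i j).eval t

/-- The entries of a rational matrix function have a common denominator. -/
theorem IsRationalSymbol.exists_isQuotient (hF : IsRationalSymbol F) :
    ∃ (q : ℂ[X]) (P : Matrix (Fin m) (Fin m) ℂ[X]), q ≠ 0 ∧ IsQuotient F q P := by
  choose p s hs hps using hF
  let Q : ℂ[X] := ∏ x : Fin m × Fin m, s x.1 x.2
  have hQ : Q ≠ 0 := Finset.prod_ne_zero_iff.2 fun x _ => hs x.1 x.2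
  -- `IsRationalSymbol` does not constrain `F` at zeros of the denominators; the second factor `Q`
  -- makes both sides vanish there.
  refine ⟨Q * Q, fun i j => Q * (p i j * ∏ x ∈ Finset.univ.erase (i, j), s x.1 x.2),
    mul_ne_zero hQ hQ, fun t ht i j => ?_⟩
  have hQij : Q = s i j * ∏ x ∈ Finset.univ.erase (i, j), s x.1 x.2 :=
    (Finset.mul_prod_erase _ (fun x : Fin m × Fin m => s x.1 x.2) (Finset.mem_univ (i, j))).symm
  rw [eval_mul, eval_mul, mul_assoc]
  by_cases h0 : Q.eval t = 0
  · rw [h0, zero_mul, zero_mul]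
  · have h1 : (s i j).eval t ≠ 0 := by
      intro h; rw [hQij, eval_mul, h, zero_mul] at h0; exact h0 rfl
    congr 1
    rw [hps i j t ht h1, hQij, eval_mul, eval_mul]
    field_simp

theorem countable_setOf_exp_eq (z : ℂ) :
    {θ : ℝ | Complex.exp (θ * Complex.I) = z}.Countable := by
  rcases Set.eq_empty_or_nonempty {θ : ℝ | Complex.exp (θ * Complex.I) = z} with h | ⟨θ₀, h₀⟩
  · rw [h]; exact Set.countable_empty
  · refine (Set.countable_range fun n : ℤ => θ₀ + n * (2 * Real.pi)).mono fun θ hθ => ?_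
    obtain ⟨n, hn⟩ := Complex.exp_eq_exp_iff_exists_int.1
      ((show Complex.exp (θ * Complex.I) = z from hθ).trans h₀.symm)
    refine ⟨n, ?_⟩
    have h1 : (θ : ℂ) = θ₀ + n * (2 * Real.pi) := by
      have : (θ : ℂ) * Complex.I = (θ₀ + n * (2 * Real.pi)) * Complex.I := by rw [hn]; ring
      exact mul_right_cancel₀ Complex.I_ne_zero this
    exact_mod_cast h1.symm

theorem ae_eval_ne_zero {p : ℂ[X]} (hp : p ≠ 0) :
    ∀ᵐ θ : ℝ, p.eval (Complex.exp (θ * Complex.I)) ≠ 0 := by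
  have hc : {θ : ℝ | p.eval (Complex.exp (θ * Complex.I)) = 0}.Countable := by
    have h1 : {θ : ℝ | p.eval (Complex.exp (θ * Complex.I)) = 0} =
        ⋃ z ∈ p.roots.toFinset, {θ : ℝ | Complex.exp (θ * Complex.I) = z} := by
      ext θ
      simp [hp]
    rw [h1]
    exact p.roots.toFinset.countable_toSet.biUnion fun z _ => countable_setOf_exp_eq z
  have h2 := hc.measure_zero MeasureTheory.volume
  rw [MeasureTheory.ae_iff]
  simpa using h2

/-- The boundary value of `P / q` at a point of the circle. -/
def boundaryValue (q : ℂ[X]) (P : Matrix (Fin m) (Fin m) ℂ[X]) (z : ℂ) :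
    Matrix (Fin m) (Fin m) ℂ :=
  (q.eval z)⁻¹ • P.map (eval z)

theorem IsQuotient.tendsto_boundaryValue (h : IsQuotient F q P) {z : ℂ} (hz : ‖z‖ = 1)
    (hq : q.eval z ≠ 0) :
    Tendsto (fun r : ℝ => F (r * z)) (𝓝[<] 1) (𝓝 (boundaryValue q P z)) := by
  have hcont : Tendsto (fun r : ℝ => (r : ℂ) * z) (𝓝[<] 1) (𝓝 z) := by
    have : Continuous fun r : ℝ => (r : ℂ) * z := by fun_prop
    have h1 := (this.tendsto 1).mono_left (nhdsWithin_le_nhds (s := Set.Iio 1))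
    simpa using h1
  have hqt := (q.continuous.tendsto z).comp hcont
  have hne : ∀ᶠ r : ℝ in 𝓝[<] 1, q.eval ((r : ℂ) * z) ≠ 0 := hqt.eventually_ne hq
  have hball : ∀ᶠ r : ℝ in 𝓝[<] 1, (r : ℂ) * z ∈ Metric.ball (0 : ℂ) 1 := by
    filter_upwards [Ioo_mem_nhdsLT (show (0 : ℝ) < 1 from one_pos)] with r hr
    rw [mem_ball_zero_iff, norm_mul, hz, mul_one, Complex.norm_real, Real.norm_eq_abs,
      abs_of_pos hr.1]
    exact hr.2
  refine tendsto_pi_nhds.2 fun i => tendsto_pi_nhds.2 fun j => ?_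
  have h2 := (hqt.inv₀ hq).mul (((P i j).continuous.tendsto z).comp hcont)
  refine h2.congr' ?_
  filter_upwards [hne, hball] with r hr1 hr2
  simp only [Function.comp]
  rw [← h _ hr2 i j, ← mul_assoc, inv_mul_cancel₀ hr1, one_mul]

/-- On the circle these polynomials equal `z ^ d * |q z|²` times the entries of `F* F - F F*`, with
indices transposed. They are those of `HasSymbol.commutator_incl`. -/
theorem isStarNormal_boundaryValue_iff {z : ℂ} (hz : ‖z‖ = 1) (hq : q.eval z ≠ 0) {d : ℕ}
    (hd : ∀ i j, (P i j).natDegree ≤ d) :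
    IsStarNormal (boundaryValue q P z) ↔ ∀ j k,
      (∑ i, P i j * revConj d (P i k) - ∑ i, revConj d (P j i) * P k i).eval z = 0 := by
  have hz0 : z ≠ 0 := by rintro rfl; simp at hz
  have h1 : ∀ j k,
      (∑ i, P i j * revConj d (P i k) - ∑ i, revConj d (P j i) * P k i).eval z =
        z ^ d * (q.eval z * star (q.eval z)) *
          ((star (boundaryValue q P z) * boundaryValue q P z) k j -
            (boundaryValue q P z * star (boundaryValue q P z)) k j) := by
    intro j k
    have hq' : star (q.eval z) ≠ 0 := star_ne_zero.2 hq
    rw [eval_sub, eval_finsetSum, eval_finsetSum, Matrix.mul_apply, Matrix.mul_apply, mul_sub,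
      Finset.mul_sum, Finset.mul_sum]
    simp only [eval_mul, eval_revConj hz (hd _ _), Matrix.star_apply, boundaryValue,
      Matrix.smul_apply, Matrix.map_apply, smul_eq_mul, star_mul', star_inv₀]
    congr 1
    · refine Finset.sum_congr rfl fun i _ => ?_
      field_simp
    · refine Finset.sum_congr rfl fun i _ => ?_
      field_simp
  constructor
  · intro h j k
    rw [h1, h.star_comm_self.eq, sub_self, mul_zero]
  · intro h
    refine ⟨Matrix.ext fun k j => sub_eq_zero.1 ?_⟩
    have h2 := (h1 j k).symm.trans (h j k)
    refine (mul_eq_zero.1 h2).resolve_left ?_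
    exact mul_ne_zero (pow_ne_zero _ hz0) (mul_ne_zero hq (star_ne_zero.2 hq))

/-- A nonzero polynomial vanishes at `exp (θ I)` only for a null set of `θ`, so almost-everywhere
normality is a polynomial identity, shared with `HasSymbol.isStarNormal_iff`. -/
theorem IsQuotient.isNormalSymbol_iff (h : IsQuotient F q P) (hq : q ≠ 0) {d : ℕ}
    (hd : ∀ i j, (P i j).natDegree ≤ d) :
    IsNormalSymbol F ↔ ∀ j k,
      ∑ i, P i j * revConj d (P i k) - ∑ i, revConj d (P j i) * P k i = 0 := by
  constructor
  · intro hn j k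
    by_contra hne
    have hfalse : ∀ᵐ _θ : ℝ, False := by
      filter_upwards [hn, ae_eval_ne_zero hq, ae_eval_ne_zero hne] with θ hθ hqθ hrθ
      obtain ⟨A, hA, hAn⟩ := hθ
      have hz : ‖Complex.exp (θ * Complex.I)‖ = 1 := Complex.norm_exp_ofReal_mul_I θ
      rw [tendsto_nhds_unique hA (h.tendsto_boundaryValue hz hqθ)] at hAn
      exact hrθ ((isStarNormal_boundaryValue_iff hz hqθ hd).1 hAn j k)
    have := hfalse.exists
    exact this.choose_spec
  · intro hr
    filter_upwards [ae_eval_ne_zero hq] with θ hqθ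
    have hz : ‖Complex.exp (θ * Complex.I)‖ = 1 := Complex.norm_exp_ofReal_mul_I θ
    refine ⟨_, h.tendsto_boundaryValue hz hqθ, (isStarNormal_boundaryValue_iff hz hqθ hd).2 ?_⟩
    intro j k
    rw [hr, eval_zero]

theorem IsQuotient.eval_det (h : IsQuotient F q P) (c : ℂ) {t : ℂ}
    (ht : t ∈ Metric.ball (0 : ℂ) 1) :
    (P - (C c * q) • (1 : Matrix (Fin m) (Fin m) ℂ[X])).det.eval t =
      q.eval t ^ m * (F t - c • (1 : Matrix (Fin m) (Fin m) ℂ)).det := by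
  rw [← coe_evalRingHom, RingHom.map_det]
  have : (evalRingHom t).mapMatrix (P - (C c * q) • (1 : Matrix (Fin m) (Fin m) ℂ[X])) =
      q.eval t • (F t - c • (1 : Matrix (Fin m) (Fin m) ℂ)) := by
    ext i j
    simp only [RingHom.mapMatrix_apply, Matrix.map_apply, Matrix.sub_apply, Matrix.smul_apply,
      smul_eq_mul, coe_evalRingHom, eval_sub, eval_mul, eval_C, mul_sub, h t ht i j,
      Matrix.one_apply]
    split_ifs <;> simp [mul_comm]
  rw [this, Matrix.det_smul, Fintype.card_fin, coe_evalRingHom]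

theorem exists_mem_ball_eval_ne_zero {p : ℂ[X]} (hp : p ≠ 0) {U : Set ℂ} (hU : IsOpen U)
    (hne : U.Nonempty) : ∃ t ∈ U, p.eval t ≠ 0 := by
  by_contra! h
  refine hp (eq_zero_of_infinite_isRoot p (Set.Infinite.mono (s := U) h ?_))
  obtain ⟨x, hx⟩ := hne
  exact infinite_of_mem_nhds x (hU.mem_nhds hx)

/-- Non-degeneracy expressed by the characteristic polynomial of the symbol. -/
theorem IsQuotient.isNondegenerateSymbol_iff (h : IsQuotient F q P) (hq : q ≠ 0)
    (hF : ∀ i j, DifferentiableOn ℂ (fun t => F t i j) (Metric.ball 0 1)) :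
    IsNondegenerateSymbol F ↔
      ∀ c, (P - (C c * q) • (1 : Matrix (Fin m) (Fin m) ℂ[X])).det ≠ 0 := by
  refine forall_congr' fun c => ⟨?_, fun hdet => ?_⟩
  · rintro ⟨t₀, ht₀, hdet⟩ h0
    have hcont : ContinuousOn (fun t => (F t - c • (1 : Matrix (Fin m) (Fin m) ℂ)).det)
        (Metric.ball 0 1) := by
      have hFc : ContinuousOn F (Metric.ball 0 1) :=
        continuousOn_pi.2 fun i => continuousOn_pi.2 fun j => (hF i j).continuousOn
      exact continuous_id.matrix_det.comp_continuousOn (hFc.sub continuousOn_const)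
    have hopen : IsOpen (Metric.ball (0 : ℂ) 1 ∩
        (fun t => (F t - c • (1 : Matrix (Fin m) (Fin m) ℂ)).det) ⁻¹' {0}ᶜ) :=
      hcont.isOpen_inter_preimage Metric.isOpen_ball isOpen_compl_singleton
    -- `q` may vanish at `t₀`; continuity of the determinant allows moving to a nearby point where
    -- it does not.
    obtain ⟨t, ⟨ht1, ht2⟩, ht3⟩ := exists_mem_ball_eval_ne_zero hq hopen ⟨t₀, ht₀, hdet⟩
    have h1 := h.eval_det c ht1
    rw [h0, eval_zero] at h1
    exact mul_ne_zero (pow_ne_zero m ht3) ht2 h1.symm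
  · obtain ⟨t, ht1, ht2⟩ := exists_mem_ball_eval_ne_zero hdet Metric.isOpen_ball
      ⟨(0 : ℂ), Metric.mem_ball_self one_pos⟩
    refine ⟨t, ht1, fun h0 => ht2 ?_⟩
    rw [h.eval_det c ht1, h0, mul_zero]

end Boundary

/-! ### From operators to symbols and back. -/

section Main

variable {m : ℕ} {H : Type*} [NormedAddCommGroup H] [InnerProductSpace ℂ H] [CompleteSpace H]
  {V S : H →L[ℂ] H} {R : H ≃ₗᵢ[ℂ] HardySpace m}

/-- On the line spanned by an eigenvector `S` is a scalar, hence normal. -/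
theorem IsPure.eq_zero_of_eigen (hS : IsPure S) {c : ℂ} {x : H} (hx : S x = c • x) : x = 0 := by
  set M : Submodule ℂ H := Submodule.span ℂ {x} with hM
  have hT : IsStarNormal (c • ContinuousLinearMap.id ℂ M) := by
    rw [ContinuousLinearMap.isStarNormal_iff_norm_eq_adjoint]
    intro y
    rw [map_smulₛₗ, ContinuousLinearMap.adjoint_id]
    simp [norm_smul]
  refine Submodule.span_singleton_eq_bot.1 (hS M _ (fun y => ?_) hT)
  obtain ⟨a, ha⟩ := Submodule.mem_span_singleton.1 y.2
  change c • (y : H) = S (y : H)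
  rw [← ha, map_smul, hx, smul_comm]

/-- The symbol of an operator commuting with the shift. -/
def symbol (R : H ≃ₗᵢ[ℂ] HardySpace m) (S : H →L[ℂ] H) (t : ℂ) : Matrix (Fin m) (Fin m) ℂ :=
  Matrix.of fun i j => (R (S (gen (constEmb R) j))).eval t i

theorem evalAt_gen {t : ℂ} (ht : ‖t‖ < 1) (j : Fin m) :
    evalAt R ht (gen (constEmb R) j) = EuclideanSpace.single j 1 := evalAt_constEmb ht _

theorem symbol_mulVec {t : ℂ} (ht : ‖t‖ < 1) (a : EuclideanSpace ℂ (Fin m)) :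
    evalAt R ht (S (constEmb R a)) = WithLp.toLp 2 (symbol R S t *ᵥ WithLp.ofLp a) := by
  rw [emb_eq_sum, map_sum, map_sum]
  ext i
  simp only [map_smul, evalAt_apply, Matrix.mulVec, dotProduct, symbol, Matrix.of_apply]
  simp [mul_comm]

/-- The value of `S x` at `t` depends only on that of `x`: on the total set `V ^ k (gen _ j)` both
sides are `t ^ k` times the value of `S (gen _ j)`. -/
theorem evalAt_apply_eq (hR : IsKolmogorovWold V R) (hV : ∀ x, ‖V x‖ = ‖x‖) (hS : Commute S V)
    {t : ℂ} (ht : ‖t‖ < 1) (x : H) :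
    evalAt R ht (S x) = evalAt R ht (S (constEmb R (evalAt R ht x))) := by
  have h : evalAt R ht ∘L S - evalAt R ht ∘L S ∘L constEmb R ∘L evalAt R ht = 0 := by
    refine (hR.isShift hV).clm_ext_zero fun k j => ?_
    simp only [_root_.sub_apply, ContinuousLinearMap.comp_apply]
    rw [commute_apply (hS.pow_right k), hR.evalAt_pow, hR.evalAt_pow, map_smul, map_smul,
      map_smul, evalAt_gen]
    exact sub_self _
  exact sub_eq_zero.1 (congrArg (· x) h)

/-- The adjoint of evaluation yields the reproducing kernel: an eigenvector of `V†` for the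
conjugate of `t`, with constant term `b`. Evaluating its decomposition `V V† + e e†` at `t` gives `w
= ‖t‖² w + b`. -/
theorem evalAt_adj (hR : IsKolmogorovWold V R) (hV : ∀ x, ‖V x‖ = ‖x‖) {t : ℂ} (ht : ‖t‖ < 1)
    (b : EuclideanSpace ℂ (Fin m)) :
    evalAt R ht (((evalAt R ht)†) b) = ((1 - ‖t‖ ^ 2 : ℝ) : ℂ)⁻¹ • b := by
  have hs := hR.isShift hV
  have hTV : ∀ x, evalAt R ht (V x) = t • evalAt R ht x := fun x => by
    simpa using hR.evalAt_pow ht 1 x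
  have hVT : (V†) (((evalAt R ht)†) b) = starRingEnd ℂ t • ((evalAt R ht)†) b := by
    refine ext_inner_right ℂ fun y => ?_
    rw [ContinuousLinearMap.adjoint_inner_left, ContinuousLinearMap.adjoint_inner_left, hTV,
      inner_smul_left, ContinuousLinearMap.adjoint_inner_left, inner_smul_right, Complex.conj_conj]
  have heT : ((constEmb R)†) (((evalAt R ht)†) b) = b := by
    refine ext_inner_right ℂ fun y => ?_
    rw [ContinuousLinearMap.adjoint_inner_left, ContinuousLinearMap.adjoint_inner_left,
      evalAt_constEmb]
  have h1 := congrArg (evalAt R ht) (hs.decomp (((evalAt R ht)†) b))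
  rw [map_add, hTV, hVT, heT, evalAt_constEmb, map_smul, smul_smul, Complex.mul_conj'] at h1
  set w := evalAt R ht (((evalAt R ht)†) b)
  have h2 : ((1 - ‖t‖ ^ 2 : ℝ) : ℂ) • w = b := by
    push_cast
    rw [sub_smul, one_smul, sub_eq_iff_eq_add]
    rw [add_comm]; exact h1.symm
  have h3 : ((1 - ‖t‖ ^ 2 : ℝ) : ℂ) ≠ 0 := by
    have : (1 - ‖t‖ ^ 2 : ℝ) ≠ 0 := by nlinarith [norm_nonneg t]
    exact_mod_cast this
  rw [← h2, smul_smul, inv_mul_cancel₀ h3, one_smul]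

/-- Testing `S` between the kernels at `t` for `b` and for `a = F(t) b` gives `κ ‖a‖²`, while
Cauchy–Schwarz bounds this by `‖S‖ κ ‖b‖ ‖a‖`; the factor `κ`, which blows up at the circle,
cancels. -/
theorem norm_symbol_apply_le (hR : IsKolmogorovWold V R) (hV : ∀ x, ‖V x‖ = ‖x‖)
    (hS : Commute S V) {t : ℂ} (ht : ‖t‖ < 1) (b : EuclideanSpace ℂ (Fin m)) :
    ‖evalAt R ht (S (constEmb R b))‖ ≤ ‖S‖ * ‖b‖ := by
  set T := evalAt R ht with hT
  set κ : ℝ := (1 - ‖t‖ ^ 2)⁻¹ with hκ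
  have hκ0 : 0 < κ := inv_pos.2 (by nlinarith [norm_nonneg t])
  have hTT : ∀ b, T ((T†) b) = (κ : ℂ) • b := fun b => by
    rw [hT, evalAt_adj hR hV, hκ]; push_cast; rfl
  have hTn : ∀ b, ‖(T†) b‖ ^ 2 = κ * ‖b‖ ^ 2 := by
    intro b
    have h1 : ⟪(T†) b, (T†) b⟫_ℂ = (κ : ℂ) * ⟪b, b⟫_ℂ := by
      rw [ContinuousLinearMap.adjoint_inner_right, hTT, inner_smul_left, Complex.conj_ofReal]
    rw [inner_self_eq_norm_sq_to_K, inner_self_eq_norm_sq_to_K] at h1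
    have h2 : ((‖(T†) b‖ ^ 2 : ℝ) : ℂ) = ((κ * ‖b‖ ^ 2 : ℝ) : ℂ) := by
      push_cast; exact h1
    exact_mod_cast h2
  set a := T (S (constEmb R b)) with ha
  have h1 : (κ : ℂ) • a = T (S ((T†) b)) := by
    rw [hT, evalAt_apply_eq hR hV hS ht, ← hT, hTT, map_smul, map_smul, map_smul]
  have h2 : κ * ‖a‖ ^ 2 ≤ ‖S‖ * ‖(T†) b‖ * ‖(T†) a‖ := by
    have h3 : ⟪S ((T†) b), (T†) a⟫_ℂ = (κ : ℂ) * (‖a‖ : ℂ) ^ 2 := by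
      rw [ContinuousLinearMap.adjoint_inner_right, ← h1, inner_smul_left, Complex.conj_ofReal,
        inner_self_eq_norm_sq_to_K]
      rfl
    have h4 := norm_inner_le_norm (𝕜 := ℂ) (S ((T†) b)) ((T†) a)
    rw [h3, norm_mul, norm_pow, Complex.norm_real, Complex.norm_real, norm_norm,
      Real.norm_of_nonneg hκ0.le] at h4
    exact h4.trans (mul_le_mul_of_nonneg_right (S.le_opNorm _) (norm_nonneg _))
  have h5 : (‖(T†) b‖ * ‖(T†) a‖) = κ * (‖b‖ * ‖a‖) := by
    refine (sq_eq_sq₀ (by positivity) (by positivity)).1 ?_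
    rw [mul_pow, hTn, hTn]; ring
  rw [mul_assoc, h5] at h2
  have h6 : ‖a‖ * ‖a‖ ≤ ‖S‖ * ‖b‖ * ‖a‖ := by
    refine le_of_mul_le_mul_left ?_ hκ0
    calc κ * (‖a‖ * ‖a‖) = κ * ‖a‖ ^ 2 := by ring
      _ ≤ _ := h2
      _ = _ := by ring
  rcases (norm_nonneg a).eq_or_lt with h0 | h0
  · rw [← h0]; positivity
  · exact le_of_mul_le_mul_right h6 h0

theorem isAnalyticSymbol_symbol (hR : IsKolmogorovWold V R) (hV : ∀ x, ‖V x‖ = ‖x‖)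
    (hS : Commute S V) : IsAnalyticSymbol (symbol R S) := by
  constructor
  · intro i j
    have h := (R (S (gen (constEmb R) j))).differentiableOn_eval
    exact (EuclideanSpace.proj (𝕜 := ℂ) i).differentiable.comp_differentiableOn h
  · refine ⟨‖S‖, fun t ht i j => ?_⟩
    have ht' : ‖t‖ < 1 := by simpa using ht
    have h1 := norm_symbol_apply_le hR hV hS ht' (EuclideanSpace.single j 1)
    rw [PiLp.norm_single, norm_one, mul_one] at h1
    exact (PiLp.norm_apply_le _ i).trans h1

theorem isAnalyticToeplitz_symbol (hR : IsKolmogorovWold V R) (hV : ∀ x, ‖V x‖ = ‖x‖)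
    (hS : Commute S V) : IsAnalyticToeplitz (symbol R S) (transport R S) := by
  intro g t ht
  have ht' : ‖t‖ < 1 := by simpa using ht
  have h1 := evalAt_apply_eq hR hV hS ht' (R.symm g)
  rw [symbol_mulVec, evalAt_apply, evalAt_apply, R.apply_symm_apply] at h1
  exact h1

theorem HasSymbol.isQuotient (hR : IsKolmogorovWold V R) {q : ℂ[X]}
    {P : Matrix (Fin m) (Fin m) ℂ[X]} (hP : HasSymbol V (constEmb R) S q P) :
    IsQuotient (symbol R S) q P := by
  intro t ht i j
  have ht' : ‖t‖ < 1 := by simpa using ht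
  have h1 := congrArg (evalAt R ht') (hP j)
  rw [hR.evalAt_aeval, map_sum] at h1
  simp only [hR.evalAt_aeval, evalAt_gen] at h1
  have h2 := congrArg (fun v : EuclideanSpace ℂ (Fin m) => v i) h1
  simpa [evalAt_apply, symbol, Pi.single_apply] using h2

/-- A vanishing determinant provides a nonzero polynomial vector `v` in the kernel of `P - c q`;
then `∑ j, v j (V) (gen e j)` is an eigenvector of `S`, which purity excludes. -/
theorem HasSymbol.det_ne_zero {K : Type*} [NormedAddCommGroup K] [InnerProductSpace ℂ K]
    [CompleteSpace K] {e : EuclideanSpace ℂ (Fin m) →L[ℂ] H} {J : H →L[ℂ] K} {U : K →L[ℂ] K}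
    (hV : IsShift V e) (hU : IsUnitaryExtension V J U) (hSV : Commute S V) {q : ℂ[X]}
    {P : Matrix (Fin m) (Fin m) ℂ[X]} (hP : HasSymbol V e S q P) (hq : q ≠ 0) (hS : IsPure S)
    (c : ℂ) : (P - (C c * q) • (1 : Matrix (Fin m) (Fin m) ℂ[X])).det ≠ 0 := by
  intro hdet
  obtain ⟨v, hv, hBv⟩ := Matrix.exists_mulVec_eq_zero_iff.2 hdet
  set B := P - (C c * q) • (1 : Matrix (Fin m) (Fin m) ℂ[X]) with hB
  have hBj : ∀ j, aeval V q (S (gen e j) - c • gen e j) = ∑ i, aeval V (B i j) (gen e i) := by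
    intro j
    rw [map_sub, hP j, map_smul]
    simp only [hB, Matrix.sub_apply, Matrix.smul_apply, Matrix.one_apply, map_sub,
      _root_.sub_apply, Finset.sum_sub_distrib, smul_eq_mul, mul_ite, mul_one, mul_zero]
    congr 1
    rw [Finset.sum_eq_single j]
    · rw [if_pos rfl, aeval_mul_apply, aeval_C, Algebra.algebraMap_eq_smul_one]; rfl
    · intro i _ hij; rw [if_neg hij]; simp
    · simp
  have hx : S (∑ j, aeval V (v j) (gen e j)) = c • ∑ j, aeval V (v j) (gen e j) := by
    rw [← sub_eq_zero]
    refine hU.aeval_injective_base hV hq ?_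
    rw [map_sum, Finset.smul_sum, ← Finset.sum_sub_distrib, map_sum]
    have h1 : ∀ j, aeval V q (S (aeval V (v j) (gen e j)) - c • aeval V (v j) (gen e j)) =
        ∑ i, aeval V (B i j * v j) (gen e i) := by
      intro j
      rw [commute_apply (commute_aeval hSV (v j)), ← map_smul, ← map_sub,
        ← aeval_mul_apply, mul_comm, aeval_mul_apply, hBj, map_sum]
      refine Finset.sum_congr rfl fun i _ => ?_
      rw [mul_comm, aeval_mul_apply]
    rw [Finset.sum_congr rfl fun j _ => h1 j, Finset.sum_comm]
    refine Finset.sum_eq_zero fun i _ => ?_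
    rw [← _root_.sum_apply, ← map_sum]
    have h2 : ∑ j, B i j * v j = 0 := congrFun hBv i
    rw [h2]; simp
  exact hv (funext fun j => hV.polynomial_eq_zero (hS.eq_zero_of_eigen hx) j)

theorem ndarn_symbol (hR : IsKolmogorovWold V R) (hV : ∀ x, ‖V x‖ = ‖x‖) (hSV : Commute S V)
    (hS : IsSubnormalOfFiniteType S) : NDARN (symbol R S) := by
  have hs := hR.isShift hV
  have hU := hs.isUnitaryExtension
  obtain ⟨N, hN, hNJ⟩ := hU.exists_extension hSV
  have := hS.finite_rank
  have hnorm := isStarNormal_of_finiteDimensional hs hU hN hNJ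
  obtain ⟨q, P, hq, hP⟩ := exists_hasSymbol_of_finiteDimensional hs hU hN hNJ
  have hquot := hP.isQuotient hR
  obtain ⟨d, hd⟩ := exists_natDegree_le P
  have han := isAnalyticSymbol_symbol hR hV hSV
  refine ⟨(hquot.isNondegenerateSymbol_iff hq han.differentiableOn).2
    (hP.det_ne_zero hs hU hSV hq hS.isPure), han, fun i j => ⟨P i j, q, hq, fun t ht h0 => ?_⟩,
    (hquot.isNormalSymbol_iff hq hd).2 ((hP.isStarNormal_iff hs hU hN hNJ hq hd).1 hnorm)⟩
  rw [eq_div_iff h0, mul_comm, hquot t ht]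

theorem commute_of_isAnalyticToeplitz (hR : IsKolmogorovWold V R)
    {F : ℂ → Matrix (Fin m) (Fin m) ℂ} (hF : IsAnalyticToeplitz F (transport R S)) :
    Commute S V := by
  ext x
  refine eq_of_eval_eq (R := R) fun t ht => ?_
  have h1 : ∀ y, (R (S y)).eval t = WithLp.toLp 2 (F t *ᵥ WithLp.ofLp ((R y).eval t)) := by
    intro y
    have := hF (R y) t ht
    rwa [transport_apply, R.symm_apply_apply] at this
  change (R (S (V x))).eval t = (R (V (S x))).eval t
  rw [h1, hR.eval_shift _ ht, hR.eval_shift _ ht, h1, WithLp.ofLp_smul, Matrix.mulVec_smul,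
    WithLp.toLp_smul]

theorem IsAnalyticToeplitz.hasSymbol (hR : IsKolmogorovWold V R)
    {F : ℂ → Matrix (Fin m) (Fin m) ℂ} (hF : IsAnalyticToeplitz F (transport R S)) {q : ℂ[X]}
    {P : Matrix (Fin m) (Fin m) ℂ[X]} (h : IsQuotient F q P) :
    HasSymbol V (constEmb R) S q P := by
  intro j
  refine eq_of_eval_eq (R := R) fun t ht => ?_
  have ht' : ‖t‖ < 1 := by simpa using ht
  rw [← evalAt_apply ht', ← evalAt_apply ht', hR.evalAt_aeval, map_sum]
  simp only [hR.evalAt_aeval, evalAt_gen]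
  have h1 := hF (R (gen (constEmb R) j)) t ht
  rw [transport_apply, R.symm_apply_apply, ← evalAt_apply ht', ← evalAt_apply ht', evalAt_gen] at h1
  rw [h1]
  ext i
  simpa [Pi.single_apply] using h t ht i j

theorem isSubnormalOfFiniteType_of_ndarn (hR : IsKolmogorovWold V R) (hV : ∀ x, ‖V x‖ = ‖x‖)
    {F : ℂ → Matrix (Fin m) (Fin m) ℂ} (hF : NDARN F)
    (hT : IsAnalyticToeplitz F (transport R S)) :
    IsSubnormalOfFiniteType S ∧ HasNoPointMasses S := by
  have hSV := commute_of_isAnalyticToeplitz hR hT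
  have hs := hR.isShift hV
  have hU := hs.isUnitaryExtension
  obtain ⟨N, hN, hNJ⟩ := hU.exists_extension hSV
  obtain ⟨q, P, hq, hquot⟩ := hF.rational.exists_isQuotient
  obtain ⟨d, hd⟩ := exists_natDegree_le P
  have hP := hT.hasSymbol hR hquot
  have hnorm := (hP.isStarNormal_iff hs hU hN hNJ hq hd).2
    ((hquot.isNormalSymbol_iff hq hd).1 hF.normal)
  have hdet := (hquot.isNondegenerateSymbol_iff hq hF.analytic.differentiableOn).1 hF.nondegenerate
  have heig : ∀ (c : ℂ) z, N z = c • z → z = 0 := fun c z =>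
    hP.eq_zero_of_eigen hs hU hN hNJ hnorm (hdet c)
  let E : NormalExtension S :=
    { K := WithLp 2 (H × H)
      incl := ⟨(sumIncl H : H →ₗ[ℂ] WithLp 2 (H × H)), hU.norm_incl⟩
      N := N
      isStarNormal := hnorm
      N_incl := hNJ }
  exact ⟨⟨⟨E⟩, isPure_of_no_eigenvectors hs hU hN hNJ hnorm heig,
    hP.finiteDimensional_range hs hU hN hNJ hq hnorm⟩, E, heig⟩

end Main

end VToeplitz

end

theorem theorem4 {H : Type*} [NormedAddCommGroup H] [InnerProductSpace ℂ H] [CompleteSpace H]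
    (m : ℕ) (V : H →L[ℂ] H) (hV : VToeplitz.IsPureIsometry V)
    (hcodim : Module.rank ℂ (H ⧸ LinearMap.range V.toLinearMap) = (m : Cardinal))
    (R : H ≃ₗᵢ[ℂ] VToeplitz.HardySpace m) (hR : VToeplitz.IsKolmogorovWold V R)
    (S : H →L[ℂ] H) :
    (VToeplitz.IsSubnormalOfFiniteType S ∧ VToeplitz.HasNoPointMasses S ∧ S ∘L V = V ∘L S) ↔
      ∃ F : ℂ → Matrix (Fin m) (Fin m) ℂ,
        VToeplitz.NDARN F ∧ VToeplitz.IsAnalyticToeplitz F (VToeplitz.transport R S) := by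
  constructor
  · rintro ⟨hS, -, hSV⟩
    exact ⟨VToeplitz.symbol R S, VToeplitz.ndarn_symbol hR hV.norm_map hSV hS,
      VToeplitz.isAnalyticToeplitz_symbol hR hV.norm_map hSV⟩
  · rintro ⟨F, hF, hT⟩
    obtain ⟨h1, h2⟩ := VToeplitz.isSubnormalOfFiniteType_of_ndarn hR hV.norm_map hF hT
    exact ⟨h1, h2, VToeplitz.commute_of_isAnalyticToeplitz hR hT⟩
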